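/- \textbf{Setting.} Fix an integer $d\ge 1$. A \emph{polynomial weighted congestion game of degree $d$}, $\Gamma$, has a finite nonempty set $N$ of $n$ players with rational weights $w_u>0$, a finite set $E$ of resources with cost functions $c_e(x)=\sum_{\nu=0}^d a_{e,\nu}x^\nu$ with rational $a_{e,\nu}\ge 0$, and a nonempty strategy set $S_u\subseteq 2^E$ for each player $u$. For a profile $s=(s_u)_{u\in N}$ of subsets of $E$ put $x_e(s)=\sum_{u:\,e\in s_u}w_u$ and $C_u(s)=w_u\sum_{e\in s_u}c_e(x_e(s))$. A state is a profile with $s_u\in S_u$ for all $u$; $\mathbf 0$ is the profile in which every player uses $\emptyset$. For a state $s$ or $s=\mathbf 0$, $\mathcal{BR}_u(s_{-u})$ is a strategy $A\in S_u$ minimizing $C_u(s_{-u},A)$, ties being broken arbitrarily. Player $u$ has a \emph{$\rho$-move} at $s$ if $C_u(s)>\rho\, C_u(s_{-u},A)$ for some $A\in S_u$. It is assumed that every strategy has positive cost for a player who is alone in the game, i.e. $c_{\min}>0$ below. The game is represented by the binary encodings of all $w_u$ and $a_{e,\nu}$ (as fractions) together with some description of the strategy sets (which need not be an explicit list); $|\Gamma|$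 is the number of bits of this representation. \textbf{Algorithm 1.} Input: $\Gamma$ and a state $s_{\rm init}$. Let $\alpha=d+1$, $p=(2d+3)(d+1)(4d)^{d+1}$, $c_{\max}=\max_u C_u(s_{\rm init})$, $c_{\min}=\min_u C_u(\mathbf 0_{-u},\mathcal{BR}_u(\mathbf 0_{-u}))$, $m=\lceil\log_2(c_{\max}/c_{\min})\rceil$, $g=np^3(1+m(1+p))^d d^d+1$, $b_i=g^{-i}c_{\max}$; start with $s=s_{\rm init}$ and $N_{\rm fixed}=\emptyset$. \begin{itemize} \item Phase $0$: while some player $u$ has $C_u(s)\ge b_1$ and an $(\alpha+\frac1p)$-move, choose such a $u$ and replace $s$ by $(s_{-u},\mathcal{BR}_u(s_{-u}))$. \item Phase $i$, for $i=1,\dots,m-1$: while some $u\in N\setminus N_{\rm fixed}$ satisfies [$b_{i+1}\le C_u(s)<b_i$ and $u$ has an $(\alpha+\frac1p)$-move] or [$C_u(s)\ge b_i$ and $u$ has a $p$-move], choose such a $u$ and replace $s$ by $(s_{-u},\mathcal{BR}_u(s_{-u}))$. Then add to $N_{\rm fixed}$ all players with $C_u(s)\ge b_i$. \item Finally add to $N_{\rm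 fixed}$ all players with $C_u(s)\ge b_m$, and return $s$. \end{itemize} \textbf{Theorem (runtime).} For constant $d$, Algorithm 1 runs in time polynomial in the number of bits of the representation of its input game, provided that best responses are computable in polynomial time. Precisely: \begin{enumerate} \item There is a polynomial $Q$, depending only on $d$, such that for every game $\Gamma$ of degree $d$, every choice of best responses, every initial state, and every choice of the moving players, Algorithm 1 has at most $Q(|\Gamma|)$ phases and performs at most $Q(|\Gamma|)$ best-response moves in each phase. \item For every program $B$ there is a program $A$ such that for every polynomial $q$ there is a polynomial $P$ with the following property. Let $\Gamma$ be a game of degree $d$ for which $B$ computes, from $\Gamma$, $u$ and $s_{-u}$, the strategy $\mathcal{BR}_u(s_{-u})$ in time at most $q(\text{input size})$, for every player $u$ and for every state $s$ and $s=\mathbf 0$. Then, for every initial state $s_{\rm init}$ and every finite list of players used to resolve the choice among several admissible players (the $t$-th listed player is the one who moves in step $t$ whenever she is admissible; a step is either one best-response move or the end of a phase), $A$ carries out a complete execution of Algorithm 1 following that list, halts after at most $P(|\Gamma|)$ steps, and outputs the whole sequence of configurations (phase, $N_{\rm fixed}$, state). \end{enumerate} Programs are those of a first-order language on binary trees with natural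 numbers in binary at the leaves; tree operations, tests and control cost one step each, and integer arithmetic costs according to the bit lengths of the operands (sum of the lengths for $+$ and $-$, product for multiplication and division, up to additive constants). -/

import Mathlib

/-! ## A machine model with a step count

Programs are terms of a small first-order language over binary trees whose leaves are natural
numbers written in binary. Tree operations are pointer operations and cost one step; arithmetic is
charged by the bit lengths of its operands (logarithmic cost, schoolbook multiplication and
division). -/

/-- Binary trees with natural numbers at the leaves. -/
inductive Data : Type
  | atom (n : ℕ) : Data
  | pair (a b : Data) : Data

namespace Data

/-- Number of bits of a tree: the binary lengths of its leaves plus one for every node. -/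
def size : Data → ℕ
  | atom n => Nat.size n + 1
  | pair a b => a.size + b.size + 1

/-- Left component (`0` for a leaf). -/
def left : Data → Data
  | atom _ => atom 0
  | pair a _ => a

/-- Right component (`0` for a leaf). -/
def right : Data → Data
  | atom _ => atom 0
  | pair _ b => b

/-- The number at a leaf (`0` for an inner node). -/
def toNat : Data → ℕ
  | atom n => n
  | pair _ _ => 0

/-- The encoding of a list: `nil` is the leaf `0`, `cons` is a pair. -/
def ofList {α : Type} (f : α → Data) : List α → Data
  | [] => atom 0
  | a :: l => pair (f a) (ofList f l)

/-- The encoding of a nonnegative rational: numerator and denominator. -/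
def ofRat (q : ℚ) : Data := pair (atom q.num.toNat) (atom q.den)

/-- The encoding of a set of resources: the list of its `k` membership bits. -/
def ofFinset {k : ℕ} (A : Finset (Fin k)) : Data :=
  ofList (fun e => atom (if e ∈ A then 1 else 0)) (List.finRange k)

end Data

/-- Programs. Each one maps a tree to a tree. -/
inductive Code : Type
  | id : Code
  | const (n : ℕ) : Code
  | left : Code
  | right : Code
  | pair (f g : Code) : Code
  | comp (f g : Code) : Code
  | add : Code
  | sub : Code
  | mul : Code
  | div : Code
  | cond (c f g : Code) : Code
  | loop (c f : Code) : Code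

/-- `Eval c x y t`: the program `c`, run on input `x`, halts with output `y` after `t` steps.
The arithmetic programs act on the two leaves of their input; subtraction is truncated.
`cond c f g` runs `g` if `c` returns the leaf `0` and `f` otherwise; `loop c f` repeats `f` as long
as `c` does not return the leaf `0`. -/
inductive Eval : Code → Data → Data → ℕ → Prop
  | id (x : Data) : Eval Code.id x x 1
  | const (n : ℕ) (x : Data) : Eval (Code.const n) x (Data.atom n) (Nat.size n + 1)
  | left (x : Data) : Eval Code.left x x.left 1
  | right (x : Data) : Eval Code.right x x.right 1
  | pair (f g : Code) (x y z : Data) (s t : ℕ) :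
      Eval f x y s → Eval g x z t → Eval (Code.pair f g) x (Data.pair y z) (s + t + 1)
  | comp (f g : Code) (x y z : Data) (s t : ℕ) :
      Eval g x y s → Eval f y z t → Eval (Code.comp f g) x z (s + t + 1)
  | add (x : Data) : Eval Code.add x (Data.atom (x.left.toNat + x.right.toNat))
      (Nat.size x.left.toNat + Nat.size x.right.toNat + 1)
  | sub (x : Data) : Eval Code.sub x (Data.atom (x.left.toNat - x.right.toNat))
      (Nat.size x.left.toNat + Nat.size x.right.toNat + 1)
  | mul (x : Data) : Eval Code.mul x (Data.atom (x.left.toNat * x.right.toNat))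
      ((Nat.size x.left.toNat + 1) * (Nat.size x.right.toNat + 1))
  | div (x : Data) : Eval Code.div x (Data.atom (x.left.toNat / x.right.toNat))
      ((Nat.size x.left.toNat + 1) * (Nat.size x.right.toNat + 1))
  | cond_true (c f g : Code) (x v y : Data) (s t : ℕ) :
      Eval c x v s → v ≠ Data.atom 0 → Eval f x y t → Eval (Code.cond c f g) x y (s + t + 1)
  | cond_false (c f g : Code) (x y : Data) (s t : ℕ) :
      Eval c x (Data.atom 0) s → Eval g x y t → Eval (Code.cond c f g) x y (s + t + 1)
  | loop_stop (c f : Code) (x : Data) (s : ℕ) :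
      Eval c x (Data.atom 0) s → Eval (Code.loop c f) x x (s + 1)
  | loop_step (c f : Code) (x v y z : Data) (r s t : ℕ) :
      Eval c x v r → v ≠ Data.atom 0 → Eval f x y s → Eval (Code.loop c f) y z t →
      Eval (Code.loop c f) x z (r + s + t + 1)

/-! ## Polynomial weighted congestion games -/

/-- A finitely represented polynomial weighted congestion game of degree `d`, with players `Fin n`
and resources `Fin k`. Resource `e` has the cost function `x ↦ ∑ ν ≤ d, coeff e ν * x ^ ν`.
A strategy set may be exponentially large, so it need not be listed: `desc` is the part of the
representation that describes the strategy sets (a graph with terminals, an explicit list, ...), in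
a format that only the best-response routine has to understand. -/
structure Game (d : ℕ) where
  n : ℕ
  k : ℕ
  n_pos : 0 < n
  weight : Fin n → ℚ
  weight_pos : ∀ u, 0 < weight u
  coeff : Fin k → Fin (d + 1) → ℚ
  coeff_nonneg : ∀ e ν, 0 ≤ coeff e ν
  strat : Fin n → Set (Finset (Fin k))
  strat_nonempty : ∀ u, (strat u).Nonempty
  desc : Data

namespace Game

variable {d : ℕ} (Γ : Game d)

/-- A set of resources for every player. -/
abbrev Profile : Type := Fin Γ.n → Finset (Fin Γ.k)

/-- The states of the game. -/
def states : Set Γ.Profile := {s | ∀ u, s u ∈ Γ.strat u}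

/-- The empty state, in which every player uses no resource. -/
def emptyState : Γ.Profile := fun _ => ∅

/-- The profile in which `u` deviates from `s` to `A`. -/
def deviate (s : Γ.Profile) (u : Fin Γ.n) (A : Finset (Fin Γ.k)) : Γ.Profile :=
  Function.update s u A

/-- The strategies of the players other than `u` in `s`, as a profile in which `u` uses nothing. -/
def others (s : Γ.Profile) (u : Fin Γ.n) : Γ.Profile := Γ.deviate s u ∅

/-- The cost function of a resource. -/
def resourceCost (e : Fin Γ.k) (x : ℚ) : ℚ := ∑ ν : Fin (d + 1), Γ.coeff e ν * x ^ (ν : ℕ)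

/-- The total weight on a resource. -/
def load (s : Γ.Profile) (e : Fin Γ.k) : ℚ := ∑ u with e ∈ s u, Γ.weight u

/-- The cost of a player. -/
def cost (u : Fin Γ.n) (s : Γ.Profile) : ℚ :=
  Γ.weight u * ∑ e ∈ s u, Γ.resourceCost e (Γ.load s e)

/-- `A` is a best response of `u` to the strategies of the other players in `s`. -/
def IsBestResponse (u : Fin Γ.n) (s : Γ.Profile) (A : Finset (Fin Γ.k)) : Prop :=
  A ∈ Γ.strat u ∧ ∀ A' ∈ Γ.strat u, Γ.cost u (Γ.deviate s u A) ≤ Γ.cost u (Γ.deviate s u A')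

/-- Player `u` has a `ρ`-move at `s`. -/
def HasMove (ρ : ℚ) (u : Fin Γ.n) (s : Γ.Profile) : Prop :=
  ∃ A ∈ Γ.strat u, ρ * Γ.cost u (Γ.deviate s u A) < Γ.cost u s

/-- Every strategy of every player has positive cost already when she is alone in the game
(equivalently, the quantity `cMin` below is positive). -/
def PositiveCosts : Prop :=
  ∀ u, ∀ A ∈ Γ.strat u, 0 < Γ.cost u (Γ.deviate Γ.emptyState u A)

/-! ### Representation -/

/-- The representation of the game. -/
def encode : Data :=
  Data.pair (Data.ofList (fun u => Data.ofRat (Γ.weight u)) (List.finRange Γ.n))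
    (Data.pair
      (Data.ofList (fun e => Data.ofList (fun ν => Data.ofRat (Γ.coeff e ν))
        (List.finRange (d + 1))) (List.finRange Γ.k))
      Γ.desc)

/-- The number of bits of the representation of the game. -/
def bits : ℕ := Γ.encode.size

def encodeProfile (s : Γ.Profile) : Data :=
  Data.ofList (fun u => Data.ofFinset (s u)) (List.finRange Γ.n)

/-! ### Best responses -/

/-- A rule that answers the strategies of the other players, given as `Γ.others s u`, by a
strategy of `u`. -/
abbrev ResponseRule : Type := Fin Γ.n → Γ.Profile → Finset (Fin Γ.k)

/-- The rule selects a best response (with arbitrary tie breaking) to the other players'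
strategies in any state, and also to the empty state. -/
def IsBestResponseRule (br : Γ.ResponseRule) : Prop :=
  ∀ u s, (s ∈ Γ.states ∨ s = Γ.emptyState) → Γ.IsBestResponse u s (br u (Γ.others s u))

/-- The input of a best-response routine: the game, a player, and the other players' strategies. -/
def brInput (u : Fin Γ.n) (s : Γ.Profile) : Data :=
  Data.pair Γ.encode (Data.pair (Data.atom u) (Γ.encodeProfile (Γ.others s u)))

/-- The program `B` computes the rule `br` on `Γ`, in time `q` of the size of its input. -/
def ComputesWithin (B : Code) (br : Γ.ResponseRule) (q : Polynomial ℕ) : Prop :=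
  ∀ u s, (s ∈ Γ.states ∨ s = Γ.emptyState) →
    ∃ t ≤ q.eval (Γ.brInput u s).size,
      Eval B (Γ.brInput u s) (Data.ofFinset (br u (Γ.others s u))) t

/-! ### The algorithm -/

/-- The parameter `α = d + 1`. -/
def alpha (d : ℕ) : ℕ := d + 1

/-- The target approximation factor `p`. -/
def target (d : ℕ) : ℕ := (2 * d + 3) * (d + 1) * (4 * d) ^ (d + 1)

/-- The smaller move threshold `α + 1 / p`. -/
def lowFactor (d : ℕ) : ℚ := alpha d + 1 / target d

theorem univ_nonempty : (Finset.univ : Finset (Fin Γ.n)).Nonempty :=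
  ⟨⟨0, Γ.n_pos⟩, Finset.mem_univ _⟩

/-- The largest cost of a player in the initial state. -/
def cMax (s₀ : Γ.Profile) : ℚ := Finset.univ.sup' Γ.univ_nonempty fun u => Γ.cost u s₀

/-- The smallest cost of a player who best-responds to the empty state. -/
def cMin (br : Γ.ResponseRule) : ℚ :=
  Finset.univ.inf' Γ.univ_nonempty fun u =>
    Γ.cost u (Γ.deviate Γ.emptyState u (br u (Γ.others Γ.emptyState u)))

/-- `m = ⌈log₂ (cMax / cMin)⌉`. -/
def logRatio (br : Γ.ResponseRule) (s₀ : Γ.Profile) : ℕ :=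
  Nat.clog 2 ⌈Γ.cMax s₀ / Γ.cMin br⌉₊

/-- The ratio `g` of successive boundaries. -/
def ratio (br : Γ.ResponseRule) (s₀ : Γ.Profile) : ℕ :=
  Γ.n * target d ^ 3 * (1 + Γ.logRatio br s₀ * (1 + target d)) ^ d * d ^ d + 1

/-- The boundaries `b i = cMax / g ^ i`. -/
def boundary (br : Γ.ResponseRule) (s₀ : Γ.Profile) (i : ℕ) : ℚ :=
  Γ.cMax s₀ / (Γ.ratio br s₀ : ℚ) ^ i

/-- The phases are `0, 1, ..., m - 1`; the preparatory phase `0` is always executed. -/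
def numPhases (br : Γ.ResponseRule) (s₀ : Γ.Profile) : ℕ := max (Γ.logRatio br s₀) 1

/-- What the algorithm keeps track of: the current phase, the set `N_fixed`, the current state. -/
structure Config where
  phase : ℕ
  fixed : Finset (Fin Γ.n)
  state : Γ.Profile

variable {Γ}

/-- Player `u` satisfies the condition of the while-loop of the current phase. -/
def Eligible (br : Γ.ResponseRule) (s₀ : Γ.Profile) (c : Γ.Config) (u : Fin Γ.n) : Prop :=
  (c.phase = 0 ∧ Γ.boundary br s₀ 1 ≤ Γ.cost u c.state ∧ Γ.HasMove (lowFactor d) u c.state) ∨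
  (1 ≤ c.phase ∧ c.phase < Γ.numPhases br s₀ ∧ u ∉ c.fixed ∧
    ((Γ.boundary br s₀ (c.phase + 1) ≤ Γ.cost u c.state ∧
        Γ.cost u c.state < Γ.boundary br s₀ c.phase ∧ Γ.HasMove (lowFactor d) u c.state) ∨
      (Γ.boundary br s₀ c.phase ≤ Γ.cost u c.state ∧ Γ.HasMove (target d) u c.state)))

/-- Player `u` makes her best-response move. -/
def Config.move (br : Γ.ResponseRule) (c : Γ.Config) (u : Fin Γ.n) : Γ.Config :=
  { c with state := Γ.deviate c.state u (br u (Γ.others c.state u)) }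

/-- The players whose current cost is at least `b i`. -/
def costly (br : Γ.ResponseRule) (s₀ : Γ.Profile) (s : Γ.Profile) (i : ℕ) : Finset (Fin Γ.n) :=
  Finset.univ.filter fun u => Γ.boundary br s₀ i ≤ Γ.cost u s

/-- The end of a phase: the main phases `i ≥ 1` fix the players whose cost is at least `b i`; after
the last phase, those whose cost is at least `b m` are fixed as well. -/
def Config.close (br : Γ.ResponseRule) (s₀ : Γ.Profile) (c : Γ.Config) : Γ.Config where
  phase := c.phase + 1
  fixed := c.fixed ∪
    (if c.phase = 0 then ∅ else costly br s₀ c.state c.phase) ∪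
    (if c.phase + 1 < Γ.numPhases br s₀ then ∅ else costly br s₀ c.state (Γ.logRatio br s₀))
  state := c.state

/-- One step of the algorithm: an eligible player, arbitrarily chosen, makes a best-response move;
if there is none, the phase ends. -/
inductive Step (br : Γ.ResponseRule) (s₀ : Γ.Profile) : Γ.Config → Γ.Config → Prop
  | move (c : Γ.Config) (u : Fin Γ.n) : Eligible br s₀ c u → Step br s₀ c (c.move br u)
  | close (c : Γ.Config) : c.phase < Γ.numPhases br s₀ → (∀ u, ¬ Eligible br s₀ c u) →
      Step br s₀ c (c.close br s₀)

/-- A (possibly unfinished) execution of the algorithm, as the list of its configurations. -/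
def IsPartialRun (br : Γ.ResponseRule) (s₀ : Γ.Profile) (L : List Γ.Config) : Prop :=
  L.head? = some ⟨0, ∅, s₀⟩ ∧ L.IsChain (Step br s₀)

/-- A finished execution: all phases have ended. -/
def IsCompleteRun (br : Γ.ResponseRule) (s₀ : Γ.Profile) (L : List Γ.Config) : Prop :=
  IsPartialRun br s₀ L ∧ ∃ c, L.getLast? = some c ∧ c.phase = Γ.numPhases br s₀

/-- The number of best-response moves in phase `i`, which is one less than the number of
configurations of that phase. -/
def movesInPhase (L : List Γ.Config) (i : ℕ) : ℕ := L.countP (fun c => c.phase = i) - 1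

/-- The list `prefs` resolves the choice among several eligible players: in the `t`-th step the
`t`-th player of `prefs` is the one who moves, if she is eligible. -/
def Follows (br : Γ.ResponseRule) (s₀ : Γ.Profile) (prefs : List (Fin Γ.n))
    (L : List Γ.Config) : Prop :=
  ∀ (t : ℕ) (c c' : Γ.Config) (u : Fin Γ.n), L[t]? = some c → L[t + 1]? = some c' →
    prefs[t]? = some u → Eligible br s₀ c u → c' = c.move br u

/-- A configuration as a tree. -/
def Config.encode (c : Γ.Config) : Data :=
  Data.pair (Data.atom c.phase) (Data.pair (Data.ofFinset c.fixed) (Γ.encodeProfile c.state))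

/-- The input of the algorithm: the game, the initial state, and a list that resolves choices. -/
def algInput (s₀ : Γ.Profile) (prefs : List (Fin Γ.n)) : Data :=
  Data.pair Γ.encode
    (Data.pair (Γ.encodeProfile s₀) (Data.ofList (fun u => Data.atom (u : ℕ)) prefs))

end Game

/-! Moves are counted with the total cost Φ(s) = ∑_e x_e c_e(x_e) (`potential`). Let F be the set of
fixed players and s|F the profile in which all others use nothing. For 0 ≤ y ≤ x one has (x - y)x^ν
≤ x^(ν+1) - y^(ν+1) ≤ (ν + 1)(x - y)x^ν. Summed over resources and monomials, this puts Φ(s) -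
Φ(s|F) between ∑_{u ∉ F} C_u(s) and d + 1 times that sum (`sum_cost_compl_le`, `le_sum_cost_compl`).
Taking for F all players but u shows that a move of u from s to s' gives Φ(s') ≤ Φ(s) - C_u(s) +
αC_u(s'). So an (α + 1/p)-move lowers Φ by at least C_u(s)/(αp + 1) (`potential_respondTo_le`).

In phase i only unfixed players move, so Φ(s|F) is constant, and each move lowers Φ(s) by at least
b_{i+1}/(αp + 1). At the start of the phase Φ(s) - Φ(s|F) ≤ (d + 1) n b_{i-1}: for i ≥ 2 because the
unfixed players have cost below b_{i-1}, for i ≤ 1 because initially all costs are at most c_max =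
b_0. As b_{i-1} = g² b_{i+1}, a phase has at most (d + 1) n g² (αp + 1) moves; `Invariant` does the
bookkeeping. After multiplication by a common denominator all costs are natural numbers, c_min is at
least 1, and so m is at most the bit length of the scaled c_max. Hence m and g, and with them the
number of moves, are polynomial in the size of the game.

For the running time the program is written out. `Runs` and `Counts` concern a program on a whole
family of inputs, with one polynomial for the family. Branches pass to subfamilies and loops to
families of pairs (input, round), so the polynomials compose. Tree operations cost one step whatever
the size of the tree, so only the bit lengths of numbers have to be controlled. All tests of the
algorithm are homogeneous in the costs and become comparisons of natural numbers (`eligible_iff`).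
The loop of `Code.algorithm` follows `trace`, which reaches the end by the bound on the moves
(`exists_trace_phase_eq`). -/

theorem Polynomial.eval_le_eval_nat (P : Polynomial ℕ) {a b : ℕ} (h : a ≤ b) :
    P.eval a ≤ P.eval b := by
  simp only [Polynomial.eval_eq_sum, Polynomial.sum]
  gcongr

/-! ## Polynomially bounded families -/

/-- The family `f` is bounded by a polynomial in the family `N`. -/
def PolyBdd {ι : Type} (N f : ι → ℕ) : Prop := ∃ P : Polynomial ℕ, ∀ i, f i ≤ P.eval (N i)

namespace PolyBdd

variable {ι κ : Type} {N M f g : ι → ℕ}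

theorem mono (hg : PolyBdd N g) (h : ∀ i, f i ≤ g i) : PolyBdd N f := by
  obtain ⟨P, hP⟩ := hg
  exact ⟨P, fun i => (h i).trans (hP i)⟩

theorem const (k : ℕ) : PolyBdd N (fun _ => k) := ⟨Polynomial.C k, fun i => by simp⟩

theorem self : PolyBdd N N := ⟨Polynomial.X, fun i => by simp⟩

theorem add (hf : PolyBdd N f) (hg : PolyBdd N g) : PolyBdd N (fun i => f i + g i) := by
  obtain ⟨P, hP⟩ := hf
  obtain ⟨Q, hQ⟩ := hg
  exact ⟨P + Q, fun i => by rw [Polynomial.eval_add]; exact add_le_add (hP i) (hQ i)⟩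

theorem mul (hf : PolyBdd N f) (hg : PolyBdd N g) : PolyBdd N (fun i => f i * g i) := by
  obtain ⟨P, hP⟩ := hf
  obtain ⟨Q, hQ⟩ := hg
  exact ⟨P * Q, fun i => by rw [Polynomial.eval_mul]; exact Nat.mul_le_mul (hP i) (hQ i)⟩

theorem pow (hf : PolyBdd N f) (k : ℕ) : PolyBdd N (fun i => f i ^ k) := by
  obtain ⟨P, hP⟩ := hf
  exact ⟨P ^ k, fun i => by rw [Polynomial.eval_pow]; exact Nat.pow_le_pow_left (hP i) k⟩

theorem poly (hf : PolyBdd N f) (q : Polynomial ℕ) : PolyBdd N (fun i => q.eval (f i)) := by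
  obtain ⟨P, hP⟩ := hf
  exact ⟨q.comp P, fun i => by rw [Polynomial.eval_comp]; exact q.eval_le_eval_nat (hP i)⟩

theorem reindex (φ : κ → ι) (h : PolyBdd N f) :
    PolyBdd (fun k => N (φ k)) (fun k => f (φ k)) := by
  obtain ⟨P, hP⟩ := h
  exact ⟨P, fun k => hP _⟩

end PolyBdd

/-- The numbers `a i` have polynomially many bits. -/
def FewBits {ι : Type} (N a : ι → ℕ) : Prop := PolyBdd N (fun i => Nat.size (a i))

namespace FewBits

variable {ι κ : Type} {N a b : ι → ℕ}

theorem mono (hb : FewBits N b) (h : ∀ i, a i ≤ b i) : FewBits N a :=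
  PolyBdd.mono hb fun i => Nat.size_le_size (h i)

theorem const (k : ℕ) : FewBits N (fun _ => k) := PolyBdd.const _

theorem of_polyBdd (h : PolyBdd N a) : FewBits N a :=
  PolyBdd.mono h fun _ => Nat.size_le.2 Nat.lt_two_pow_self

theorem of_lt {f : ι → ℕ} (hf : PolyBdd N f) (h : ∀ i, a i < 2 ^ f i) : FewBits N a :=
  PolyBdd.mono hf fun i => Nat.size_le.2 (h i)

theorem mul (ha : FewBits N a) (hb : FewBits N b) : FewBits N (fun i => a i * b i) := by
  refine of_lt (PolyBdd.add ha hb) fun i => ?_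
  rw [pow_add]
  exact Nat.mul_lt_mul'' (Nat.lt_size_self _) (Nat.lt_size_self _)

theorem add (ha : FewBits N a) (hb : FewBits N b) : FewBits N (fun i => a i + b i) := by
  refine of_lt ((PolyBdd.add ha hb).add (PolyBdd.const 1)) fun i => ?_
  have h1 := Nat.lt_size_self (a i)
  have h2 := Nat.lt_size_self (b i)
  have h3 : 2 ^ Nat.size (a i) ≤ 2 ^ (Nat.size (a i) + Nat.size (b i)) :=
    Nat.pow_le_pow_right (by norm_num) (by omega)
  have h4 : 2 ^ Nat.size (b i) ≤ 2 ^ (Nat.size (a i) + Nat.size (b i)) :=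
    Nat.pow_le_pow_right (by norm_num) (by omega)
  rw [pow_succ]
  omega

theorem reindex (φ : κ → ι) (h : FewBits N a) : FewBits (fun k => N (φ k)) (fun k => a (φ k)) :=
  PolyBdd.reindex φ h

/-- At most `K i` factors below 2^P have a product below 2^(K i * P + 1). A loop needs this twice:
for the intermediate products, over index sets depending on the counter, and for the final one. -/
theorem prod {K : ι → ℕ} (hK : PolyBdd N K) {f : ∀ i, Fin (K i) → ℕ}
    (hf : FewBits (fun p : Σ i, Fin (K i) => N p.1) (fun p => f p.1 p.2))
    (s : ∀ i, ℕ → Finset (Fin (K i))) :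
    FewBits (fun p : Σ i, Fin (K i) => N p.1) (fun p => ∏ j ∈ s p.1 p.2, f p.1 j) ∧
    FewBits N (fun i => ∏ j ∈ s i (K i), f i j) := by
  obtain ⟨P, hP⟩ := hf
  have key : ∀ i (t : Finset (Fin (K i))), ∏ j ∈ t, f i j < 2 ^ (K i * P.eval (N i) + 1) := by
    intro i t
    have h1 : ∏ j ∈ t, f i j ≤ ∏ _j ∈ t, 2 ^ P.eval (N i) :=
      Finset.prod_le_prod' fun j _ => (Nat.size_le.1 (hP ⟨i, j⟩)).le
    rw [Finset.prod_const, ← pow_mul] at h1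
    refine (h1.trans (Nat.pow_le_pow_right (by norm_num) ?_)).trans_lt
      (Nat.pow_lt_pow_right (by norm_num) (Nat.lt_succ_self _))
    rw [mul_comm]
    exact Nat.mul_le_mul_right _ (by simpa using Finset.card_le_univ t)
  have hb : PolyBdd N (fun i => K i * P.eval (N i) + 1) :=
    (hK.mul (PolyBdd.self.poly P)).add (PolyBdd.const 1)
  exact ⟨of_lt (hb.reindex Sigma.fst) fun p => key _ _, of_lt hb fun i => key _ _⟩

theorem sum {K : ι → ℕ} (hK : PolyBdd N K) {f : ∀ i, Fin (K i) → ℕ}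
    (hf : FewBits (fun p : Σ i, Fin (K i) => N p.1) (fun p => f p.1 p.2)) :
    FewBits N (fun i => ∑ j, f i j) := by
  obtain ⟨P, hP⟩ := hf
  refine of_lt (f := fun i => K i + P.eval (N i)) (hK.add (PolyBdd.self.poly P)) fun i => ?_
  have h1 : ∑ j, f i j ≤ ∑ _j : Fin (K i), 2 ^ P.eval (N i) :=
    Finset.sum_le_sum fun j _ => (Nat.size_le.1 (hP ⟨i, j⟩)).le
  rw [Finset.sum_const, Finset.card_univ, Fintype.card_fin, smul_eq_mul] at h1
  rw [pow_add]
  exact h1.trans_lt (Nat.mul_lt_mul_of_pos_right Nat.lt_two_pow_self (by positivity))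

/-- The exponent itself must be polynomially bounded, not only its bit length. -/
theorem pow (ha : FewBits N a) (hb : PolyBdd N b) : FewBits N (fun i => a i ^ b i) := by
  have := (FewBits.prod (f := fun i _ => a i) hb (ha.reindex Sigma.fst)
    (fun i _ => Finset.univ)).2
  simpa using this

end FewBits

/-! ## Running programs on families of inputs -/

infixr:67 " ∷ " => Data.pair
infixr:67 " ▹ " => Code.pair

/-- On the inputs `x i`, the program `c` returns `y i` in time polynomial in `N i`. -/
def Runs {ι : Type} (N : ι → ℕ) (c : Code) (x y : ι → Data) : Prop :=
  ∃ t : ι → ℕ, PolyBdd N t ∧ ∀ i, Eval c (x i) (y i) (t i)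

namespace Code

/-- The `k`-th entry of a tuple. -/
def var : ℕ → Code
  | 0 => left
  | k + 1 => comp (var k) right

/-- The program `c` in a context with one more entry in front. -/
def wk (c : Code) : Code := comp c right

/-- `1` if the value of `c` is not zero, `0` otherwise. -/
def test (c : Code) : Code := cond c (const 1) (const 0)

def and (c f : Code) : Code := cond c f (const 0)

def or (c f : Code) : Code := cond c (const 1) f

def not (c : Code) : Code := cond c (const 0) (const 1)

/-- Comparison of numbers. -/
def lt (f g : Code) : Code := test (comp sub (g ▹ f))

/-- Equality of numbers. -/
def eq (f g : Code) : Code := (lt f g).not.and (lt g f).not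

/-- Run `b` for `j = 0, 1, ..., n - 1` on the tuple consisting of `j`, an accumulator and the
input, where `n` is the value of `nc`; the accumulator starts with the value of `ac`. -/
def forLoop (nc ac b : Code) : Code :=
  comp (var 1) (comp
    (loop (comp sub (var 2 ▹ var 0))
      (comp add (var 0 ▹ const 1) ▹ comp b (var 0 ▹ var 1 ▹ comp right (comp right right)) ▹
        comp right right))
    (const 0 ▹ ac ▹ nc ▹ id))

/-- The sum of the values of `f` in the context `j ∷ x` for `j` less than the value of `nc`. -/
def sumLoop (nc f : Code) : Code :=
  forLoop nc (const 0) (comp add (var 1 ▹ comp f (var 0 ▹ comp right right)))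

def prodLoop (nc f : Code) : Code :=
  forLoop nc (const 1) (comp mul (var 1 ▹ comp f (var 0 ▹ comp right right)))

/-- The larger of two numbers: `a + (b - a)`. -/
def max (f g : Code) : Code := comp add (f ▹ comp sub (g ▹ f))

def supLoop (nc f : Code) : Code :=
  forLoop nc (const 0) (max (var 1) (comp f (var 0 ▹ comp right right)))

/-- The list of the values of `f` in the contexts `j ∷ x` for `j` less than the value of `nc`. -/
def table (nc f : Code) : Code :=
  forLoop nc (const 0)
    (comp f (comp sub (comp sub (comp nc (comp right right) ▹ const 1) ▹ var 0) ▹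
      comp right right) ▹ var 1)

/-- `f ^ g` -/
def pow (f g : Code) : Code := prodLoop g (wk f)

/-- The entry of the list `f` with index `g`. -/
def nth (f g : Code) : Code := comp left (forLoop g f (comp right (var 1)))

/-- The length of a list. -/
def length (f : Code) : Code :=
  comp (var 1) (comp (loop left (comp right left ▹ comp add (var 1 ▹ const 1) ▹ const 0))
    (f ▹ const 0 ▹ const 0))

/-- The reversal of a list. -/
def reverse (f : Code) : Code :=
  comp (var 1) (comp (loop left (comp right left ▹ (comp left left ▹ var 1) ▹ const 0))
    (f ▹ const 0 ▹ const 0))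

/-- `0` if `f` returns `0` in all contexts `j ∷ x` for `j` less than the value of `nc`, and `j + 1`
for the first exception `j` otherwise. -/
def search (nc f : Code) : Code :=
  forLoop nc (const 0) (cond (var 1) (var 1)
    (cond (comp f (var 0 ▹ comp right right)) (comp add (var 0 ▹ const 1)) (const 0)))

end Code

/-- The tree without its first `k` entries. -/
def Data.dropEntries : ℕ → Data → Data
  | 0, x => x
  | k + 1, x => dropEntries k x.right

namespace Runs

variable {ι κ : Type} {N : ι → ℕ} {c f g : Code} {x y z : ι → Data}

/-- `Eval` records exact step counts, while running time estimates only give upper bounds. -/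
theorem of_le {t : ι → ℕ} (ht : PolyBdd N t) (h : ∀ i, ∃ s ≤ t i, Eval c (x i) (y i) s) :
    Runs N c x y := by
  choose s hs h using h
  exact ⟨s, ht.mono hs, h⟩

theorem reindex (φ : κ → ι) (h : Runs N c x y) :
    Runs (fun k => N (φ k)) c (fun k => x (φ k)) (fun k => y (φ k)) := by
  obtain ⟨t, ht, h⟩ := h
  exact ⟨fun k => t (φ k), ht.reindex φ, fun k => h _⟩

theorem congr {y' : ι → Data} (h : Runs N c x y) (e : ∀ i, y i = y' i) : Runs N c x y' := by
  rwa [← funext e]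

theorem id : Runs N Code.id x x := ⟨_, PolyBdd.const 1, fun _ => Eval.id _⟩

theorem const (n : ℕ) : Runs N (Code.const n) x (fun _ => Data.atom n) :=
  ⟨_, PolyBdd.const _, fun _ => Eval.const n _⟩

theorem left : Runs N Code.left x (fun i => (x i).left) := ⟨_, PolyBdd.const 1, fun _ => Eval.left _⟩

theorem right : Runs N Code.right x (fun i => (x i).right) :=
  ⟨_, PolyBdd.const 1, fun _ => Eval.right _⟩

theorem pair (hf : Runs N f x y) (hg : Runs N g x z) :
    Runs N (f ▹ g) x (fun i => y i ∷ z i) := by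
  obtain ⟨s, hs, hf⟩ := hf
  obtain ⟨t, ht, hg⟩ := hg
  exact ⟨_, (hs.add ht).add (PolyBdd.const 1), fun i => Eval.pair _ _ _ _ _ _ _ (hf i) (hg i)⟩

theorem comp (hg : Runs N g x y) (hf : Runs N f y z) : Runs N (Code.comp f g) x z := by
  obtain ⟨s, hs, hf⟩ := hf
  obtain ⟨t, ht, hg⟩ := hg
  exact ⟨_, (ht.add hs).add (PolyBdd.const 1), fun i => Eval.comp _ _ _ _ _ _ _ (hg i) (hf i)⟩

theorem var (k : ℕ) : Runs N (Code.var k) x (fun i => ((x i).dropEntries k).left) := by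
  induction k generalizing x with
  | zero => exact left
  | succ k ih => exact right.comp ih

theorem wk {a : ι → Data} (h : Runs N c x y) : Runs N c.wk (fun i => a i ∷ x i) y :=
  Runs.comp right h

-- A branch need only work on the inputs that reach it, hence the subtypes. The polynomials found
-- there also make sense on the whole family, where their sum covers both branches.
open Classical in
theorem cond {v : ι → Data} (hc : Runs N c x v)
    (hf : Runs (fun i : {i // v i ≠ Data.atom 0} => N i) f (fun i => x i) (fun i => y i))
    (hg : Runs (fun i : {i // v i = Data.atom 0} => N i) g (fun i => x i) (fun i => y i)) :
    Runs N (Code.cond c f g) x y := by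
  obtain ⟨r, hr, hc⟩ := hc
  obtain ⟨s, ⟨P, hs⟩, hf⟩ := hf
  obtain ⟨t, ⟨Q, ht⟩, hg⟩ := hg
  refine of_le ((hr.add ((PolyBdd.self.poly P).add (PolyBdd.self.poly Q))).add
    (PolyBdd.const 1)) fun i => ?_
  by_cases h : v i = Data.atom 0
  · refine ⟨_, ?_, Eval.cond_false _ _ _ _ _ _ _ (h ▸ hc i) (hg ⟨i, h⟩)⟩
    have := ht ⟨i, h⟩
    simp only at this ⊢
    omega
  · refine ⟨_, ?_, Eval.cond_true _ _ _ _ _ _ _ _ (hc i) h (hf ⟨i, h⟩)⟩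
    have := hs ⟨i, h⟩
    simp only at this ⊢
    omega

/-- Test and body are analysed on the family of pairs (input, round), so that one polynomial in `N`
bounds every round; there are `K` rounds. -/
theorem loop {K : ι → ℕ} (hK : PolyBdd N K) {x : ι → ℕ → Data} {v : (i : ι) → Fin (K i) → Data}
    (hc : Runs (fun p : Σ i, Fin (K i) => N p.1) c (fun p => x p.1 p.2) (fun p => v p.1 p.2))
    (hv : ∀ i j, v i j ≠ Data.atom 0)
    (hf : Runs (fun p : Σ i, Fin (K i) => N p.1) f (fun p => x p.1 p.2)
      (fun p => x p.1 (p.2 + 1)))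
    (he : Runs N c (fun i => x i (K i)) (fun _ => Data.atom 0)) :
    Runs N (Code.loop c f) (fun i => x i 0) (fun i => x i (K i)) := by
  obtain ⟨r, ⟨P, hr⟩, hc⟩ := hc
  obtain ⟨s, ⟨Q, hs⟩, hf⟩ := hf
  obtain ⟨t, ht, he⟩ := he
  have hb : PolyBdd N (fun i => K i * (P.eval (N i) + Q.eval (N i) + 1) + (t i + 1)) :=
    (hK.mul (((PolyBdd.self.poly P).add (PolyBdd.self.poly Q)).add (PolyBdd.const 1))).add
      (ht.add (PolyBdd.const 1))
  refine of_le hb fun i => ?_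
  -- Induction on the number `l` of rounds still to come, because `Eval` builds a loop from its end.
  have key : ∀ l ≤ K i, ∃ u ≤ l * (P.eval (N i) + Q.eval (N i) + 1) + (t i + 1),
      Eval (Code.loop c f) (x i (K i - l)) (x i (K i)) u := by
    intro l
    induction l with
    | zero => exact fun _ => ⟨_, by simp, Eval.loop_stop _ _ _ _ (he i)⟩
    | succ l ih =>
      intro hl
      obtain ⟨u, hu, h⟩ := ih (by omega)
      have hj : K i - (l + 1) < K i := by omega
      have h1 := hc ⟨i, ⟨_, hj⟩⟩
      have h2 := hf ⟨i, ⟨_, hj⟩⟩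
      have h3 := hr ⟨i, ⟨_, hj⟩⟩
      have h4 := hs ⟨i, ⟨_, hj⟩⟩
      simp only [show K i - (l + 1) + 1 = K i - l by omega] at h1 h2 h3 h4
      refine ⟨_, ?_, Eval.loop_step _ _ _ _ _ _ _ _ _ h1 (hv i _) h2 h⟩
      rw [add_mul]
      omega
  simpa using key (K i) le_rfl

end Runs

/-- On the inputs `x i`, the program `c` returns the number `a i` in time polynomial in `N i`, and
`a i` has polynomially many bits. -/
structure Counts {ι : Type} (N : ι → ℕ) (c : Code) (x : ι → Data) (a : ι → ℕ) : Prop where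
  run : Runs N c x (fun i => Data.atom (a i))
  few : FewBits N a

namespace Counts

variable {ι : Type} {N : ι → ℕ} {c f g nc : Code} {x : ι → Data} {a b K : ι → ℕ}

theorem reindex {κ : Type} (φ : κ → ι) (h : Counts N c x a) :
    Counts (fun k => N (φ k)) c (fun k => x (φ k)) (fun k => a (φ k)) :=
  ⟨h.run.reindex φ, h.few.reindex φ⟩

theorem congr {a' : ι → ℕ} (h : Counts N c x a) (e : ∀ i, a i = a' i) : Counts N c x a' := by
  rwa [← funext e]

theorem comp {y : ι → Data} (hg : Runs N g x y) (hf : Counts N f y a) :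
    Counts N (Code.comp f g) x a := ⟨hg.comp hf.run, hf.few⟩

theorem wk {z : ι → Data} (h : Counts N c x a) : Counts N c.wk (fun i => z i ∷ x i) a :=
  ⟨h.run.wk, h.few⟩

theorem var (k : ℕ) (h : FewBits N a) (hx : ∀ i, ((x i).dropEntries k).left = Data.atom (a i)) :
    Counts N (Code.var k) x a := ⟨(Runs.var k).congr hx, h⟩

theorem const (n : ℕ) : Counts N (Code.const n) x (fun _ => n) :=
  ⟨Runs.const n, FewBits.const n⟩

theorem add (hf : Counts N f x a) (hg : Counts N g x b) :
    Counts N (Code.comp Code.add (f ▹ g)) x (fun i => a i + b i) :=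
  ⟨(hf.run.pair hg.run).comp ⟨_, (PolyBdd.add hf.few hg.few).add (PolyBdd.const 1),
    fun _ => Eval.add _⟩, hf.few.add hg.few⟩

theorem sub (hf : Counts N f x a) (hg : Counts N g x b) :
    Counts N (Code.comp Code.sub (f ▹ g)) x (fun i => a i - b i) :=
  ⟨(hf.run.pair hg.run).comp ⟨_, (PolyBdd.add hf.few hg.few).add (PolyBdd.const 1),
    fun _ => Eval.sub _⟩, hf.few.mono fun _ => Nat.sub_le _ _⟩

theorem mul (hf : Counts N f x a) (hg : Counts N g x b) :
    Counts N (Code.comp Code.mul (f ▹ g)) x (fun i => a i * b i) :=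
  ⟨(hf.run.pair hg.run).comp ⟨_, (PolyBdd.add hf.few (PolyBdd.const 1)).mul
    (PolyBdd.add hg.few (PolyBdd.const 1)), fun _ => Eval.mul _⟩, hf.few.mul hg.few⟩

theorem div (hf : Counts N f x a) (hg : Counts N g x b) :
    Counts N (Code.comp Code.div (f ▹ g)) x (fun i => a i / b i) :=
  ⟨(hf.run.pair hg.run).comp ⟨_, (PolyBdd.add hf.few (PolyBdd.const 1)).mul
    (PolyBdd.add hg.few (PolyBdd.const 1)), fun _ => Eval.div _⟩,
    hf.few.mono fun _ => Nat.div_le_self _ _⟩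

theorem max (hf : Counts N f x a) (hg : Counts N g x b) :
    Counts N (Code.max f g) x (fun i => Max.max (a i) (b i)) :=
  (hf.add (hg.sub hf)).congr fun i => by omega

end Counts

namespace Runs

variable {ι : Type} {N : ι → ℕ} {x : ι → Data}

/-- Nothing is assumed about the size of the accumulator: the loop moves it by pointer operations,
and its own arithmetic concerns only the counter. -/
theorem forLoop {nc ac b : Code} {K : ι → ℕ} (hK : PolyBdd N K)
    (hn : Runs N nc x (fun i => Data.atom (K i))) {a : ι → ℕ → Data}
    (h0 : Runs N ac x (fun i => a i 0))
    (hb : Runs (fun p : Σ i, Fin (K i) => N p.1) b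
      (fun p => Data.atom p.2 ∷ a p.1 p.2 ∷ x p.1) (fun p => a p.1 (p.2 + 1))) :
    Runs N (Code.forLoop nc ac b) x (fun i => a i (K i)) := by
  have hj : FewBits (fun p : Σ i, Fin (K i) => N p.1) (fun p => (p.2 : ℕ)) :=
    FewBits.of_polyBdd ((hK.reindex Sigma.fst).mono fun p => p.2.2.le)
  refine Runs.comp (y := fun i => Data.atom (K i) ∷ a i (K i) ∷ Data.atom (K i) ∷ x i) ?_
    (Runs.var 1)
  refine Runs.comp (y := fun i => Data.atom 0 ∷ a i 0 ∷ Data.atom (K i) ∷ x i)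
    ((Runs.const 0).pair (h0.pair (hn.pair Runs.id))) ?_
  refine Runs.loop (x := fun i j => Data.atom j ∷ a i j ∷ Data.atom (K i) ∷ x i) hK
    (v := fun i j => Data.atom (K i - j)) ?_ ?_ ?_ ?_
  · exact ((Counts.var 2 ((FewBits.of_polyBdd hK).reindex Sigma.fst) fun _ => rfl).sub
      (Counts.var 0 hj fun _ => rfl)).run
  · rintro i j h
    simp only [Data.atom.injEq] at h
    have := j.2
    omega
  · exact Runs.pair ((Counts.var 0 hj fun _ => rfl).add (Counts.const 1)).run
      (Runs.pair (Runs.comp ((Runs.var 0).pair ((Runs.var 1).pair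
        (Runs.comp (Runs.comp Runs.right Runs.right) Runs.right))) hb)
        (Runs.comp Runs.right Runs.right))
  · exact ((Counts.var 2 (FewBits.of_polyBdd hK) fun _ => rfl).sub
      (Counts.var 0 (FewBits.of_polyBdd hK) fun _ => rfl)).run.congr fun i => by simp

/-- Lists grow at the front, so the entries are computed from the last to the first: round `j`
evaluates `f` at `K - 1 - j`, and after `j` rounds the accumulator holds the last `j` entries. -/
theorem table {nc f : Code} {K : ι → ℕ} (hK : PolyBdd N K)
    (hn : Runs N nc x (fun i => Data.atom (K i))) {y : ∀ i, Fin (K i) → Data}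
    (hf : Runs (fun p : Σ i, Fin (K i) => N p.1) f (fun p => Data.atom p.2 ∷ x p.1)
      (fun p => y p.1 p.2)) :
    Runs N (Code.table nc f) x (fun i => Data.ofList (y i) (List.finRange (K i))) := by
  have hj : FewBits (fun p : Σ i, Fin (K i) => N p.1) (fun p => (p.2 : ℕ)) :=
    FewBits.of_polyBdd ((hK.reindex Sigma.fst).mono fun p => p.2.2.le)
  have hc : Counts N nc x K := ⟨hn, FewBits.of_polyBdd hK⟩
  refine (Runs.forLoop hK hn (a := fun i j =>
    Data.ofList (y i) ((List.finRange (K i)).drop (K i - j)))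
    ((Runs.const 0).congr fun i => ?_) ?_).congr fun i => by simp
  · rw [List.drop_eq_nil_of_le (by simp)]
    rfl
  · refine (Runs.pair (Runs.comp (y := fun p => Data.atom (p.2.rev : ℕ) ∷ x p.1) ?_
      (hf.reindex fun p : Σ i, Fin (K i) => (⟨p.1, p.2.rev⟩ : Σ i, Fin (K i))))
      (Runs.var 1)).congr fun p => ?_
    · refine Runs.pair ((((Counts.comp (Runs.comp Runs.right Runs.right)
        (hc.reindex Sigma.fst)).sub (Counts.const 1)).sub
        (Counts.var 0 hj fun _ => rfl)).run.congr fun p => ?_) (Runs.comp Runs.right Runs.right)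
      rw [Fin.val_rev]
      congr 1
      omega
    · obtain ⟨i, j⟩ := p
      have hj := j.2
      have e : K i - (j + 1) < (List.finRange (K i)).length := by simp; omega
      simp only
      rw [List.drop_eq_getElem_cons e, show K i - (j + 1) + 1 = K i - j by omega]
      simp only [Data.ofList, List.getElem_finRange]
      congr 2

end Runs

/-- This holds beyond the end as well: `right` of a leaf is the leaf `0`, which encodes the empty
list. -/
theorem Data.dropEntries_ofList {α : Type} (f : α → Data) (l : List α) (k : ℕ) :
    (ofList f l).dropEntries k = ofList f (l.drop k) := by
  induction k generalizing l with
  | zero => rfl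
  | succ k ih =>
    cases l with
    | nil => simpa [dropEntries, ofList, right] using ih []
    | cons a l => simpa [dropEntries, ofList, right] using ih l

theorem Data.right_dropEntries (x : Data) (k : ℕ) :
    (x.dropEntries k).right = x.dropEntries (k + 1) := by
  induction k generalizing x with
  | zero => rfl
  | succ k ih => exact ih x.right

theorem Data.length_le_size_ofList {α : Type} (f : α → Data) (l : List α) :
    l.length ≤ (ofList f l).size := by
  induction l with
  | nil => simp
  | cons a l ih =>
    simp only [List.length_cons, ofList, size]
    omega

theorem Data.size_le_size_ofList {α : Type} (f : α → Data) {l : List α} {a : α} (h : a ∈ l) :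
    (f a).size ≤ (ofList f l).size := by
  induction l with
  | nil => simp at h
  | cons b l ih =>
    simp only [ofList, size]
    rcases List.mem_cons.1 h with rfl | h
    · omega
    · have := ih h
      omega

theorem Data.size_ofList_le {α : Type} (f : α → Data) (l : List α) {b : ℕ}
    (h : ∀ a ∈ l, (f a).size ≤ b) : (ofList f l).size ≤ l.length * (b + 1) + 1 := by
  induction l with
  | nil => simp [ofList, size]
  | cons a l ih =>
    have h1 := ih fun a ha => h a (List.mem_cons_of_mem _ ha)
    have h2 := h a List.mem_cons_self
    simp only [ofList, size, List.length_cons, add_mul]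
    omega

open Classical in
/-- The truth value as a leaf. -/
noncomputable def Data.bool (p : Prop) : Data := atom (if p then 1 else 0)

/-- On the inputs `x i`, the program `c` decides `p i` in time polynomial in `N i`. -/
def Decides {ι : Type} (N : ι → ℕ) (c : Code) (x : ι → Data) (p : ι → Prop) : Prop :=
  Runs N c x (fun i => Data.bool (p i))

@[simp] theorem Data.bool_eq_zero {p : Prop} : bool p = atom 0 ↔ ¬ p := by
  unfold bool
  split_ifs <;> simp [*]

theorem Data.bool_of {p : Prop} (h : p) : bool p = atom 1 := by simp [bool, h]

theorem Data.bool_of_not {p : Prop} (h : ¬ p) : bool p = atom 0 := by simp [bool, h]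

namespace Runs

variable {ι : Type} {N : ι → ℕ} {c f g : Code} {x y : ι → Data} {p : ι → Prop}

theorem ite (hc : Decides N c x p)
    (hf : Runs (fun i : {i // p i} => N i) f (fun i => x i) (fun i => y i))
    (hg : Runs (fun i : {i // ¬ p i} => N i) g (fun i => x i) (fun i => y i)) :
    Runs N (Code.cond c f g) x y :=
  Runs.cond hc
    (hf.reindex fun i : {i // Data.bool (p i) ≠ Data.atom 0} =>
      ⟨i.1, not_not.1 fun h => i.2 (Data.bool_eq_zero.2 h)⟩)
    (hg.reindex fun i : {i // Data.bool (p i) = Data.atom 0} => ⟨i.1, Data.bool_eq_zero.1 i.2⟩)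

theorem test {v : ι → Data} (hc : Runs N c x v) :
    Decides N c.test x (fun i => v i ≠ Data.atom 0) :=
  Runs.cond hc ((Runs.const 1).congr fun i => (Data.bool_of i.2).symm)
    ((Runs.const 0).congr fun i => (Data.bool_of_not (not_not.2 i.2)).symm)

theorem nth {j : ι → ℕ} {α : ι → Type} {e : ∀ i, α i → Data}
    {l : ∀ i, List (α i)} {a : ∀ i, α i} (hf : Runs N f x (fun i => Data.ofList (e i) (l i)))
    (hg : Runs N g x (fun i => Data.atom (j i))) (hj : PolyBdd N j)
    (ha : ∀ i, (l i)[j i]? = some (a i)) :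
    Runs N (Code.nth f g) x (fun i => e i (a i)) := by
  refine (Runs.comp (Runs.forLoop (a := fun i k => (Data.ofList (e i) (l i)).dropEntries k)
    hj hg hf ((Runs.comp (Runs.var 1) Runs.right).congr fun p => ?_)) Runs.left).congr fun i => ?_
  · exact Data.right_dropEntries _ _
  · obtain ⟨h, e⟩ := List.getElem?_eq_some_iff.1 (ha i)
    rw [Data.dropEntries_ofList, List.drop_eq_getElem_cons h, e]
    rfl

/-- Table look-up. -/
theorem nth_finRange {K : ι → ℕ} {y : ∀ i, Fin (K i) → Data} {j : ∀ i, Fin (K i)}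
    (hK : PolyBdd N K)
    (hf : Runs N f x (fun i => Data.ofList (y i) (List.finRange (K i))))
    (hg : Runs N g x (fun i => Data.atom (j i))) :
    Runs N (Code.nth f g) x (fun i => y i (j i)) :=
  Runs.nth hf hg (hK.mono fun i => (j i).2.le) fun i => by
    simp

/-- The remaining list serves as its own loop test: it is a pair, hence not the leaf `0`, as long as
it is nonempty. `Counts.length` uses the same device. -/
theorem reverse {α : ι → Type} {e : ∀ i, α i → Data} {l : ∀ i, List (α i)}
    (hl : PolyBdd N (fun i => (l i).length))
    (hf : Runs N f x (fun i => Data.ofList (e i) (l i))) :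
    Runs N (Code.reverse f) x (fun i => Data.ofList (e i) (l i).reverse) := by
  refine (Runs.comp (y := fun i => Data.ofList (e i) ((l i).drop (l i).length) ∷
    Data.ofList (e i) ((l i).take (l i).length).reverse ∷ Data.atom 0) ?_ (Runs.var 1)).congr
    fun i => by simp [Data.dropEntries, Data.left, Data.right]
  refine Runs.comp (hf.pair ((Runs.const 0).pair (Runs.const 0))) ?_
  refine Runs.loop (x := fun i k => Data.ofList (e i) ((l i).drop k) ∷
    Data.ofList (e i) ((l i).take k).reverse ∷ Data.atom 0) hl
    (v := fun i j => e i (l i)[j] ∷ Data.ofList (e i) ((l i).drop (j + 1)))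
    (Runs.left.congr fun p => ?_) ?_ ?_ ?_
  · change Data.ofList (e p.1) ((l p.1).drop p.2) = _
    rw [List.drop_eq_getElem_cons p.2.2]
    rfl
  · simp
  · refine (Runs.pair (Runs.comp Runs.left Runs.right) (Runs.pair (Runs.pair
      (Runs.comp Runs.left Runs.left) (Runs.var 1)) (Runs.const 0))).congr fun p => ?_
    simp only [List.drop_eq_getElem_cons p.2.2, Data.ofList, Data.left, Data.right,
      Data.dropEntries, List.take_succ_eq_append_getElem p.2.2, List.reverse_append,
      List.reverse_singleton, List.singleton_append]
  · exact Runs.left.congr fun i => by simp [Data.left, Data.ofList]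

end Runs


/-! ### Sums, products and maxima by loops; decision programs. -/

theorem Fin.filter_val_lt_succ {n : ℕ} (j : Fin n) :
    (Finset.univ.filter fun k : Fin n => (k : ℕ) < j + 1) =
      insert j (Finset.univ.filter fun k : Fin n => (k : ℕ) < j) := by
  ext k
  simp only [Finset.mem_filter, Finset.mem_univ, true_and, Finset.mem_insert, Fin.ext_iff]
  omega

namespace Counts

variable {ι : Type} {N : ι → ℕ} {f g nc ac bc : Code} {x : ι → Data} {a b K : ι → ℕ}

theorem forLoop (hK : PolyBdd N K) (hn : Runs N nc x (fun i => Data.atom (K i)))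
    {w : ι → ℕ → ℕ} (h0 : Runs N ac x (fun i => Data.atom (w i 0)))
    (hw : FewBits N (fun i => w i (K i)))
    (hb : Runs (fun p : Σ i, Fin (K i) => N p.1) bc
      (fun p => Data.atom p.2 ∷ Data.atom (w p.1 p.2) ∷ x p.1)
      (fun p => Data.atom (w p.1 (p.2 + 1)))) :
    Counts N (Code.forLoop nc ac bc) x (fun i => w i (K i)) :=
  ⟨Runs.forLoop (a := fun i j => Data.atom (w i j)) hK hn h0 hb, hw⟩

theorem underLoop {z : (Σ i, Fin (K i)) → Data} {v : (Σ i, Fin (K i)) → ℕ}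
    (hf : Counts (fun p : Σ i, Fin (K i) => N p.1) f (fun p => Data.atom p.2 ∷ x p.1) v) :
    Counts (fun p : Σ i, Fin (K i) => N p.1)
      (Code.comp f (Code.var 0 ▹ Code.comp Code.right Code.right))
      (fun p => Data.atom p.2 ∷ z p ∷ x p.1) v :=
  Counts.comp ((Runs.var 0).pair (Runs.comp Runs.right Runs.right)) hf

/-- Partial sums are at most the full sum, which bounds the bits of the accumulator. -/
theorem sum (hK : PolyBdd N K) (hn : Runs N nc x (fun i => Data.atom (K i)))
    {v : ∀ i, Fin (K i) → ℕ}
    (hf : Counts (fun p : Σ i, Fin (K i) => N p.1) f (fun p => Data.atom p.2 ∷ x p.1)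
      (fun p => v p.1 p.2)) :
    Counts N (Code.sumLoop nc f) x (fun i => ∑ j, v i j) := by
  have hs := FewBits.sum hK hf.few
  refine (Counts.forLoop
    (w := fun i k => ∑ j ∈ Finset.univ.filter fun j : Fin (K i) => (j : ℕ) < k, v i j) hK hn
    ((Runs.const 0).congr fun i => by simp) (hs.mono fun i => ?_) ?_).congr fun i => by simp
  · exact Finset.sum_le_sum_of_subset (Finset.filter_subset _ _)
  · refine ((Counts.var 1 ((hs.reindex Sigma.fst).mono fun p => ?_) fun _ => rfl).add
      hf.underLoop).run.congr fun p => ?_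
    · exact Finset.sum_le_sum_of_subset (Finset.filter_subset _ _)
    · rw [Fin.filter_val_lt_succ, Finset.sum_insert (by simp), add_comm]

/-- A partial product can exceed the full product when a later factor is zero, so the accumulator
needs the first half of `FewBits.prod`. -/
theorem prod (hK : PolyBdd N K) (hn : Runs N nc x (fun i => Data.atom (K i)))
    {v : ∀ i, Fin (K i) → ℕ}
    (hf : Counts (fun p : Σ i, Fin (K i) => N p.1) f (fun p => Data.atom p.2 ∷ x p.1)
      (fun p => v p.1 p.2)) :
    Counts N (Code.prodLoop nc f) x (fun i => ∏ j, v i j) := by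
  have hs := FewBits.prod hK hf.few fun i k => Finset.univ.filter fun j => (j : ℕ) < k
  refine (Counts.forLoop
    (w := fun i k => ∏ j ∈ Finset.univ.filter fun j : Fin (K i) => (j : ℕ) < k, v i j) hK hn
    ((Runs.const 1).congr fun i => by simp) hs.2 ?_).congr fun i => by simp
  refine ((Counts.var 1 hs.1 fun _ => rfl).mul hf.underLoop).run.congr fun p => ?_
  rw [Fin.filter_val_lt_succ, Finset.prod_insert (by simp), mul_comm]

theorem sup (hK : PolyBdd N K) (hn : Runs N nc x (fun i => Data.atom (K i)))
    {v : ∀ i, Fin (K i) → ℕ}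
    (hf : Counts (fun p : Σ i, Fin (K i) => N p.1) f (fun p => Data.atom p.2 ∷ x p.1)
      (fun p => v p.1 p.2)) :
    Counts N (Code.supLoop nc f) x (fun i => Finset.univ.sup (v i)) := by
  have hs : FewBits N (fun i => Finset.univ.sup (v i)) := (FewBits.sum hK hf.few).mono fun i =>
    Finset.sup_le fun j hj => Finset.single_le_sum (f := v i) (fun _ _ => Nat.zero_le _) hj
  refine (Counts.forLoop (w := fun i k => (Finset.univ.filter fun j : Fin (K i) => (j : ℕ) < k).sup
    (v i)) hK hn ((Runs.const 0).congr fun i => by simp) (hs.mono fun i => ?_) ?_).congr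
    fun i => by simp
  · exact Finset.sup_mono (Finset.filter_subset _ _)
  · refine ((Counts.var 1 ((hs.reindex Sigma.fst).mono fun p => ?_) fun _ => rfl).max
      hf.underLoop).run.congr fun p => ?_
    · exact Finset.sup_mono (Finset.filter_subset _ _)
    · rw [Fin.filter_val_lt_succ, Finset.sup_insert, sup_comm]

theorem pow (hf : Counts N f x a) (hg : Counts N g x b) (hb : PolyBdd N b) :
    Counts N (Code.pow f g) x (fun i => a i ^ b i) :=
  (Counts.prod (v := fun i _ => a i) hb hg.run (hf.reindex Sigma.fst).wk).congr fun i => by simp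

theorem length {α : ι → Type} {e : ∀ i, α i → Data} {l : ∀ i, List (α i)}
    (hl : PolyBdd N (fun i => (l i).length))
    (hf : Runs N f x (fun i => Data.ofList (e i) (l i))) :
    Counts N (Code.length f) x (fun i => (l i).length) := by
  refine ⟨?_, FewBits.of_polyBdd hl⟩
  refine Runs.comp (y := fun i => Data.ofList (e i) ((l i).drop (l i).length) ∷
    Data.atom (l i).length ∷ Data.atom 0) ?_ (Runs.var 1)
  refine Runs.comp (hf.pair ((Runs.const 0).pair (Runs.const 0))) ?_
  refine Runs.loop (x := fun i k => Data.ofList (e i) ((l i).drop k) ∷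
    Data.atom k ∷ Data.atom 0) hl (v := fun i j => e i (l i)[j] ∷
    Data.ofList (e i) ((l i).drop (j + 1))) (Runs.left.congr fun p => ?_) ?_ ?_ ?_
  · change Data.ofList (e p.1) ((l p.1).drop p.2) = _
    rw [List.drop_eq_getElem_cons p.2.2]
    rfl
  · simp
  · refine (Runs.pair (Runs.comp Runs.left Runs.right) (Runs.pair
      ((Counts.var 1 (FewBits.of_polyBdd ((hl.reindex Sigma.fst).mono fun p => p.2.2.le))
        fun _ => rfl).add (Counts.const 1)).run (Runs.const 0))).congr fun p => ?_
    simp only [List.drop_eq_getElem_cons p.2.2, Data.ofList, Data.left, Data.right]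
  · exact Runs.left.congr fun i => by simp [Data.left, Data.ofList]

end Counts

namespace Decides

variable {ι : Type} {N : ι → ℕ} {f g : Code} {x : ι → Data} {a b : ι → ℕ} {p q : ι → Prop}

theorem reindex {κ : Type} (φ : κ → ι) (h : Decides N f x p) :
    Decides (fun k => N (φ k)) f (fun k => x (φ k)) (fun k => p (φ k)) :=
  Runs.reindex φ h

theorem congr {p' : ι → Prop} (h : Decides N f x p) (e : ∀ i, p i ↔ p' i) : Decides N f x p' :=
  Runs.congr h fun i => by rw [e i]

theorem comp {y : ι → Data} (hg : Runs N g x y) (hf : Decides N f y p) :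
    Decides N (Code.comp f g) x p := Runs.comp hg hf

theorem not (hf : Decides N f x p) : Decides N f.not x (fun i => ¬ p i) :=
  Runs.ite hf ((Runs.const 0).congr fun i => (Data.bool_of_not (not_not.2 i.2)).symm)
    ((Runs.const 1).congr fun i => (Data.bool_of i.2).symm)

theorem and (hf : Decides N f x p) (hg : Decides N g x q) :
    Decides N (f.and g) x (fun i => p i ∧ q i) :=
  Runs.ite hf ((hg.reindex Subtype.val).congr fun i => by simp [i.2])
    ((Runs.const 0).congr fun i => (Data.bool_of_not fun h => i.2 h.1).symm)

theorem or (hf : Decides N f x p) (hg : Decides N g x q) :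
    Decides N (f.or g) x (fun i => p i ∨ q i) :=
  Runs.ite hf ((Runs.const 1).congr fun i => (Data.bool_of (Or.inl i.2)).symm)
    ((hg.reindex Subtype.val).congr fun i => by simp [i.2])

theorem lt (hf : Counts N f x a) (hg : Counts N g x b) :
    Decides N (Code.lt f g) x (fun i => a i < b i) :=
  (Runs.test (hg.sub hf).run).congr fun i => by
    simp only [ne_eq, Data.atom.injEq]
    omega

theorem le (hf : Counts N f x a) (hg : Counts N g x b) :
    Decides N (Code.lt g f).not x (fun i => a i ≤ b i) :=
  (lt hg hf).not.congr fun _ => not_lt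

theorem eq (hf : Counts N f x a) (hg : Counts N g x b) :
    Decides N (Code.eq f g) x (fun i => a i = b i) :=
  ((lt hf hg).not.and (lt hg hf).not).congr fun i => by omega

end Decides

/-! ## Integral costs -/

namespace Game

variable {d : ℕ} (Γ : Game d)

/-- A common denominator of the weights. -/
def weightDen : ℕ := ∏ u, (Γ.weight u).den

/-- A common denominator of the coefficients. -/
def coeffDen : ℕ := ∏ e, ∏ ν, (Γ.coeff e ν).den

/-- The quotient is exact, because the denominator is one of the factors of `weightDen`. The same
holds in `natCoeff`. -/
def natWeight (u : Fin Γ.n) : ℕ := (Γ.weight u).num.toNat * (Γ.weightDen / (Γ.weight u).den)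

def natCoeff (e : Fin Γ.k) (ν : Fin (d + 1)) : ℕ :=
  (Γ.coeff e ν).num.toNat * (Γ.coeffDen / (Γ.coeff e ν).den)

def natLoad (s : Γ.Profile) (e : Fin Γ.k) : ℕ := ∑ u, if e ∈ s u then Γ.natWeight u else 0

/-- The power of `weightDen` homogenises the polynomial: when the load is multiplied by `weightDen`,
all monomials acquire the common factor `weightDen ^ d`. -/
def natResourceCost (e : Fin Γ.k) (x : ℕ) : ℕ :=
  ∑ ν : Fin (d + 1), Γ.natCoeff e ν * x ^ (ν : ℕ) * Γ.weightDen ^ (d - ν)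

/-- The cost of a player, multiplied by `Γ.scale`. -/
def natCost (u : Fin Γ.n) (s : Γ.Profile) : ℕ :=
  Γ.natWeight u * ∑ e, if e ∈ s u then Γ.natResourceCost e (Γ.natLoad s e) else 0

def scale : ℕ := Γ.weightDen ^ (d + 1) * Γ.coeffDen

theorem weightDen_pos : 0 < Γ.weightDen := Finset.prod_pos fun u _ => (Γ.weight u).den_pos

theorem coeffDen_pos : 0 < Γ.coeffDen :=
  Finset.prod_pos fun e _ => Finset.prod_pos fun ν _ => (Γ.coeff e ν).den_pos

theorem scale_pos : 0 < Γ.scale := mul_pos (pow_pos Γ.weightDen_pos _) Γ.coeffDen_pos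

end Game

theorem Rat.toNat_num_mul_div {q : ℚ} (hq : 0 ≤ q) {D : ℕ} (h : q.den ∣ D) :
    ((q.num.toNat * (D / q.den) : ℕ) : ℚ) = D * q := by
  have h1 : ((q.num.toNat : ℕ) : ℚ) = q.num := by
    exact_mod_cast congrArg (Int.cast : ℤ → ℚ) (Int.toNat_of_nonneg (Rat.num_nonneg.2 hq))
  have h2 : (q.den : ℚ) ≠ 0 := by exact_mod_cast q.den_ne_zero
  rw [Nat.cast_mul, h1, Nat.cast_div h h2]
  nth_rewrite 3 [← Rat.num_div_den q]
  ring

namespace Game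

variable {d : ℕ} (Γ : Game d)

theorem natWeight_eq (u : Fin Γ.n) : (Γ.natWeight u : ℚ) = Γ.weightDen * Γ.weight u :=
  Rat.toNat_num_mul_div (Γ.weight_pos u).le (Finset.dvd_prod_of_mem _ (Finset.mem_univ u))

theorem natCoeff_eq (e : Fin Γ.k) (ν : Fin (d + 1)) :
    (Γ.natCoeff e ν : ℚ) = Γ.coeffDen * Γ.coeff e ν :=
  Rat.toNat_num_mul_div (Γ.coeff_nonneg e ν)
    ((Finset.dvd_prod_of_mem (fun ν => (Γ.coeff e ν).den) (Finset.mem_univ ν)).trans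
      (Finset.dvd_prod_of_mem (fun e => ∏ ν, (Γ.coeff e ν).den) (Finset.mem_univ e)))

theorem natLoad_eq (s : Γ.Profile) (e : Fin Γ.k) :
    (Γ.natLoad s e : ℚ) = Γ.weightDen * Γ.load s e := by
  simp [natLoad, load, Finset.sum_filter, Finset.mul_sum, natWeight_eq, apply_ite Nat.cast]

theorem natResourceCost_eq (s : Γ.Profile) (e : Fin Γ.k) :
    (Γ.natResourceCost e (Γ.natLoad s e) : ℚ) =
      Γ.coeffDen * Γ.weightDen ^ d * Γ.resourceCost e (Γ.load s e) := by
  simp only [natResourceCost, resourceCost, Nat.cast_sum, Nat.cast_mul, Nat.cast_pow, natCoeff_eq,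
    natLoad_eq, Finset.mul_sum]
  refine Finset.sum_congr rfl fun ν _ => ?_
  have : (Γ.weightDen : ℚ) ^ d = Γ.weightDen ^ (ν : ℕ) * Γ.weightDen ^ (d - ν) := by
    rw [← pow_add, Nat.add_sub_cancel' (Nat.lt_succ_iff.1 ν.2)]
  rw [this, mul_pow]
  ring

/-- The weight contributes one factor `weightDen`, the resource costs contribute `coeffDen *
weightDen ^ d`. The factor `scale` does not depend on the player or the profile, so it cancels in
every comparison of costs. -/
theorem natCost_eq (u : Fin Γ.n) (s : Γ.Profile) : (Γ.natCost u s : ℚ) = Γ.scale * Γ.cost u s := by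
  have h : (s u).sum (fun e => Γ.resourceCost e (Γ.load s e)) =
      ∑ e, if e ∈ s u then Γ.resourceCost e (Γ.load s e) else 0 := by
    rw [← Finset.sum_filter]
    simp
  rw [natCost, cost, h, Nat.cast_mul, natWeight_eq, Nat.cast_sum, scale]
  simp only [apply_ite Nat.cast, natResourceCost_eq, Finset.mul_sum, Nat.cast_zero]
  push_cast
  refine Finset.sum_congr rfl fun e _ => ?_
  split_ifs
  · ring
  · simp

end Game

/-! ## Programs for costs and deviations -/

namespace Code

/-- The number of players of the game `g`. -/
def players (g : Code) : Code := length (comp left g)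

/-- The number of resources of the game `g`. -/
def resources (g : Code) : Code := length (comp left (comp right g))

def weightAt (g u : Code) : Code := nth (comp left g) u

def coeffAt (g e ν : Code) : Code := nth (nth (comp left (comp right g)) e) ν

/-- Input: game. -/
def weightDen : Code := prodLoop (players (var 0)) (comp right (weightAt (var 1) (var 0)))

/-- Input: game. -/
def coeffDen (d : ℕ) : Code :=
  prodLoop (resources (var 0)) (prodLoop (const (d + 1))
    (comp right (coeffAt (var 2) (var 1) (var 0))))

/-- Input: game, player. -/
def natWeight : Code :=
  comp mul (comp left (weightAt (var 0) (var 1)) ▹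
    comp div (comp weightDen (var 0 ▹ const 0) ▹ comp right (weightAt (var 0) (var 1))))

/-- Input: game, resource, exponent. -/
def natCoeff (d : ℕ) : Code :=
  comp mul (comp left (coeffAt (var 0) (var 1) (var 2)) ▹
    comp div (comp (coeffDen d) (var 0 ▹ const 0) ▹
      comp right (coeffAt (var 0) (var 1) (var 2))))

/-- Input: game, profile, resource. -/
def natLoad : Code :=
  sumLoop (players (var 0)) (cond (nth (nth (var 2) (var 0)) (var 3))
    (comp natWeight (var 1 ▹ var 0 ▹ const 0)) (const 0))

/-- Input: game, resource, number. -/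
def natResourceCost (d : ℕ) : Code :=
  sumLoop (const (d + 1)) (comp mul (comp mul
    (comp (natCoeff d) (var 1 ▹ var 2 ▹ var 0 ▹ const 0) ▹ pow (var 3) (var 0)) ▹
      pow (comp weightDen (var 1 ▹ const 0)) (comp sub (const d ▹ var 0))))

/-- Input: game, profile, player. -/
def natCost (d : ℕ) : Code :=
  comp mul (comp natWeight (var 0 ▹ var 2 ▹ const 0) ▹
    sumLoop (resources (var 0)) (cond (nth (nth (var 2) (var 3)) (var 0))
      (comp (natResourceCost d) (var 1 ▹ var 0 ▹
        comp natLoad (var 1 ▹ var 2 ▹ var 0 ▹ const 0) ▹ const 0)) (const 0)))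

/-- The empty set of resources of the game `g`. -/
def emptySet (g : Code) : Code := table (resources g) (const 0)

/-- Input: game, profile, player, strategy. -/
def deviate : Code :=
  table (players (var 0)) (cond (eq (var 0) (var 3)) (var 4) (nth (var 2) (var 0)))

/-- The profile of the game `g` in which nobody uses a resource. -/
def emptyState (g : Code) : Code := table (players g) (wk (emptySet g))

/-- Input: game, profile, player. -/
def others : Code := comp deviate (var 0 ▹ var 1 ▹ var 2 ▹ emptySet (var 0) ▹ const 0)

/-- The answer of the best-response routine `B`. Input: game, profile, player. -/
def respond (B : Code) : Code := comp B (var 0 ▹ var 2 ▹ others)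

/-- The profile after the best response. Input: game, profile, player. -/
def bestMove (B : Code) : Code := comp deviate (var 0 ▹ var 1 ▹ var 2 ▹ respond B ▹ const 0)

end Code

theorem FewBits.fin {ι : Type} {N K : ι → ℕ} (hK : PolyBdd N K) (j : ∀ i, Fin (K i)) :
    FewBits N (fun i => (j i : ℕ)) :=
  FewBits.of_polyBdd (hK.mono fun i => (j i).2.le)

theorem Counts.ite {ι : Type} {N : ι → ℕ} {c f g : Code} {x : ι → Data} {p : ι → Prop}
    {a b : ι → ℕ} [∀ i, Decidable (p i)] (hc : Decides N c x p) (hf : Counts N f x a)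
    (hg : Counts N g x b) :
    Counts N (Code.cond c f g) x (fun i => if p i then a i else b i) :=
  ⟨Runs.ite hc ((hf.run.reindex Subtype.val).congr fun i => by rw [if_pos i.2])
    ((hg.run.reindex Subtype.val).congr fun i => by rw [if_neg i.2]),
    (hf.few.add hg.few).mono fun i => by split_ifs <;> omega⟩

theorem Data.ofFinset_eq {k : ℕ} (A : Finset (Fin k)) :
    ofFinset A = ofList (fun e => bool (e ∈ A)) (List.finRange k) := by
  unfold ofFinset bool
  congr 1
  ext e
  congr

/-! ### Correctness and running time of the programs for costs and deviations. -/

namespace Game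

theorem n_le_bits {d : ℕ} (Γ : Game d) : Γ.n ≤ Γ.bits := by
  have := Data.length_le_size_ofList (fun u => Data.ofRat (Γ.weight u)) (List.finRange Γ.n)
  rw [List.length_finRange] at this
  simp only [bits, encode, Data.size]
  omega

theorem k_le_bits {d : ℕ} (Γ : Game d) : Γ.k ≤ Γ.bits := by
  have := Data.length_le_size_ofList (fun e => Data.ofList (fun ν => Data.ofRat (Γ.coeff e ν))
        (List.finRange (d + 1))) (List.finRange Γ.k)
  rw [List.length_finRange] at this
  simp only [bits, encode, Data.size]
  omega

theorem size_weight_le {d : ℕ} (Γ : Game d) (u : Fin Γ.n) :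
    (Data.ofRat (Γ.weight u)).size ≤ Γ.bits := by
  have := Data.size_le_size_ofList (fun u => Data.ofRat (Γ.weight u)) (List.mem_finRange u)
  simp only [bits, encode, Data.size]
  omega

theorem size_coeff_le {d : ℕ} (Γ : Game d) (e : Fin Γ.k) (ν : Fin (d + 1)) :
    (Data.ofRat (Γ.coeff e ν)).size ≤ Γ.bits := by
  have h1 := Data.size_le_size_ofList (fun e => Data.ofList (fun ν => Data.ofRat (Γ.coeff e ν))
        (List.finRange (d + 1))) (List.mem_finRange e)
  have h2 := Data.size_le_size_ofList (fun ν => Data.ofRat (Γ.coeff e ν)) (List.mem_finRange ν)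
  simp only [bits, encode, Data.size]
  omega

end Game

namespace Game

variable {ι : Type} {N : ι → ℕ} {d : ℕ} {Γ : ι → Game d} {x : ι → Data} {g f c uc ec ac : Code}

theorem polyBdd_n (hΓ : PolyBdd N fun i => (Γ i).bits) : PolyBdd N fun i => (Γ i).n :=
  hΓ.mono fun i => (Γ i).n_le_bits

theorem polyBdd_k (hΓ : PolyBdd N fun i => (Γ i).bits) : PolyBdd N fun i => (Γ i).k :=
  hΓ.mono fun i => (Γ i).k_le_bits

theorem counts_players (hΓ : PolyBdd N fun i => (Γ i).bits)
    (hg : Runs N g x fun i => (Γ i).encode) : Counts N (Code.players g) x fun i => (Γ i).n :=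
  (Counts.length (l := fun i => List.finRange (Γ i).n)
    ((polyBdd_n hΓ).mono fun i => by simp) (hg.comp Runs.left)).congr fun i => by simp

theorem counts_resources (hΓ : PolyBdd N fun i => (Γ i).bits)
    (hg : Runs N g x fun i => (Γ i).encode) : Counts N (Code.resources g) x fun i => (Γ i).k :=
  (Counts.length (l := fun i => List.finRange (Γ i).k)
    ((polyBdd_k hΓ).mono fun i => by simp) ((hg.comp Runs.right).comp Runs.left)).congr
    fun i => by simp

theorem runs_weightAt (hΓ : PolyBdd N fun i => (Γ i).bits)
    (hg : Runs N g x fun i => (Γ i).encode) {u : ∀ i, Fin (Γ i).n}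
    (hu : Runs N uc x fun i => Data.atom (u i)) :
    Runs N (Code.weightAt g uc) x fun i => Data.ofRat ((Γ i).weight (u i)) :=
  Runs.nth_finRange (polyBdd_n hΓ) (hg.comp Runs.left) hu

theorem runs_coeffAt (hΓ : PolyBdd N fun i => (Γ i).bits)
    (hg : Runs N g x fun i => (Γ i).encode) {e : ∀ i, Fin (Γ i).k} {ν : ι → Fin (d + 1)}
    (he : Runs N ec x fun i => Data.atom (e i)) (hν : Runs N c x fun i => Data.atom (ν i)) :
    Runs N (Code.coeffAt g ec c) x fun i => Data.ofRat ((Γ i).coeff (e i) (ν i)) :=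
  Runs.nth_finRange (K := fun _ => d + 1) (PolyBdd.const _)
    (Runs.nth_finRange (polyBdd_k hΓ) ((hg.comp Runs.right).comp Runs.left) he) hν

theorem counts_num {q : ι → ℚ} {M : ι → ℕ} (hM : PolyBdd N M)
    (hq : ∀ i, (Data.ofRat (q i)).size ≤ M i) (hf : Runs N f x fun i => Data.ofRat (q i)) :
    Counts N (Code.comp Code.left f) x fun i => (q i).num.toNat :=
  ⟨hf.comp Runs.left, hM.mono fun i => by
    have := hq i
    simp only [Data.ofRat, Data.size] at this ⊢
    omega⟩

theorem counts_den {q : ι → ℚ} {M : ι → ℕ} (hM : PolyBdd N M)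
    (hq : ∀ i, (Data.ofRat (q i)).size ≤ M i) (hf : Runs N f x fun i => Data.ofRat (q i)) :
    Counts N (Code.comp Code.right f) x fun i => (q i).den :=
  ⟨hf.comp Runs.right, hM.mono fun i => by
    have := hq i
    simp only [Data.ofRat, Data.size] at this ⊢
    omega⟩

theorem counts_weightDen (hΓ : PolyBdd N fun i => (Γ i).bits) :
    Counts N Code.weightDen (fun i => (Γ i).encode ∷ Data.atom 0) fun i => (Γ i).weightDen := by
  refine Counts.prod (polyBdd_n hΓ) (counts_players hΓ (Runs.var 0)).run ?_
  exact counts_den (hΓ.reindex Sigma.fst) (fun p => (Γ p.1).size_weight_le p.2)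
    (runs_weightAt (Γ := fun p : Σ i, Fin (Γ i).n => Γ p.1) (hΓ.reindex Sigma.fst)
      (Runs.var 1) (Runs.var 0))

theorem counts_coeffDen (hΓ : PolyBdd N fun i => (Γ i).bits) :
    Counts N (Code.coeffDen d) (fun i => (Γ i).encode ∷ Data.atom 0) fun i => (Γ i).coeffDen := by
  refine Counts.prod (polyBdd_k hΓ) (counts_resources hΓ (Runs.var 0)).run ?_
  refine Counts.prod (K := fun _ => d + 1) (PolyBdd.const _) (Runs.const _) ?_
  exact counts_den ((hΓ.reindex Sigma.fst).reindex Sigma.fst)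
    (fun p => (Γ p.1.1).size_coeff_le p.1.2 p.2)
    (runs_coeffAt (Γ := fun p : Σ _ : (Σ i, Fin (Γ i).k), Fin (d + 1) => Γ p.1.1)
      ((hΓ.reindex Sigma.fst).reindex Sigma.fst) (Runs.var 2) (e := fun p => p.1.2)
      (Runs.var 1) (Runs.var 0))

theorem counts_natWeight (hΓ : PolyBdd N fun i => (Γ i).bits) (u : ∀ i, Fin (Γ i).n) :
    Counts N Code.natWeight (fun i => (Γ i).encode ∷ Data.atom (u i) ∷ Data.atom 0)
      fun i => (Γ i).natWeight (u i) := by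
  have hw := runs_weightAt hΓ (u := u)
    (x := fun i => (Γ i).encode ∷ Data.atom (u i) ∷ Data.atom 0) (Runs.var 0) (Runs.var 1)
  exact (counts_num hΓ (fun i => (Γ i).size_weight_le (u i)) hw).mul
    ((Counts.comp ((Runs.var 0).pair (Runs.const 0)) (counts_weightDen hΓ)).div
      (counts_den hΓ (fun i => (Γ i).size_weight_le (u i)) hw))

theorem counts_natCoeff (hΓ : PolyBdd N fun i => (Γ i).bits) (e : ∀ i, Fin (Γ i).k)
    (ν : ι → Fin (d + 1)) :
    Counts N (Code.natCoeff d)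
      (fun i => (Γ i).encode ∷ Data.atom (e i) ∷ Data.atom (ν i) ∷ Data.atom 0)
      fun i => (Γ i).natCoeff (e i) (ν i) := by
  have hw := runs_coeffAt hΓ (e := e) (ν := ν)
    (x := fun i => (Γ i).encode ∷ Data.atom (e i) ∷ Data.atom (ν i) ∷ Data.atom 0)
    (Runs.var 0) (Runs.var 1) (Runs.var 2)
  exact (counts_num hΓ (fun i => (Γ i).size_coeff_le (e i) (ν i)) hw).mul
    ((Counts.comp ((Runs.var 0).pair (Runs.const 0)) (counts_coeffDen hΓ)).div
      (counts_den hΓ (fun i => (Γ i).size_coeff_le (e i) (ν i)) hw))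

theorem decides_mem {K : ι → ℕ} (hK : PolyBdd N K) {A : ∀ i, Finset (Fin (K i))}
    {e : ∀ i, Fin (K i)} (hf : Runs N f x fun i => Data.ofFinset (A i))
    (he : Runs N ec x fun i => Data.atom (e i)) :
    Decides N (Code.nth f ec) x fun i => e i ∈ A i :=
  Runs.nth_finRange hK (hf.congr fun i => Data.ofFinset_eq (A i)) he

theorem runs_strategy (hΓ : PolyBdd N fun i => (Γ i).bits) {s : ∀ i, (Γ i).Profile}
    {u : ∀ i, Fin (Γ i).n} (hf : Runs N f x fun i => (Γ i).encodeProfile (s i))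
    (hu : Runs N uc x fun i => Data.atom (u i)) :
    Runs N (Code.nth f uc) x fun i => Data.ofFinset (s i (u i)) :=
  Runs.nth_finRange (polyBdd_n hΓ) hf hu

theorem counts_natLoad (hΓ : PolyBdd N fun i => (Γ i).bits) (s : ∀ i, (Γ i).Profile)
    (e : ∀ i, Fin (Γ i).k) :
    Counts N Code.natLoad
      (fun i => (Γ i).encode ∷ (Γ i).encodeProfile (s i) ∷ Data.atom (e i) ∷ Data.atom 0)
      fun i => (Γ i).natLoad (s i) (e i) := by
  refine Counts.sum (polyBdd_n hΓ) (counts_players hΓ (Runs.var 0)).run ?_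
  have h := hΓ.reindex (Sigma.fst : (Σ i, Fin (Γ i).n) → ι)
  exact Counts.ite (decides_mem (polyBdd_k h)
      (runs_strategy h (s := fun p => s p.1) (u := fun p => p.2) (Runs.var 2) (Runs.var 0))
      (Runs.var 3))
    (Counts.comp ((Runs.var 1).pair ((Runs.var 0).pair (Runs.const 0)))
      (counts_natWeight h fun p => p.2))
    (Counts.const 0)

theorem counts_natResourceCost (hΓ : PolyBdd N fun i => (Γ i).bits) (e : ∀ i, Fin (Γ i).k)
    {a : ι → ℕ} (ha : FewBits N a) :
    Counts N (Code.natResourceCost d)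
      (fun i => (Γ i).encode ∷ Data.atom (e i) ∷ Data.atom (a i) ∷ Data.atom 0)
      fun i => (Γ i).natResourceCost (e i) (a i) := by
  refine Counts.sum (K := fun _ => d + 1) (PolyBdd.const _) (Runs.const _) ?_
  have h := hΓ.reindex (Sigma.fst : (Σ _ : ι, Fin (d + 1)) → ι)
  have hν : PolyBdd (fun p : Σ _ : ι, Fin (d + 1) => N p.1) fun p => (p.2 : ℕ) :=
    (PolyBdd.const d).mono fun p => Nat.lt_succ_iff.1 p.2.2
  refine Counts.mul (Counts.mul (Counts.comp ((Runs.var 1).pair ((Runs.var 2).pair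
    ((Runs.var 0).pair (Runs.const 0)))) (counts_natCoeff h (fun p => e p.1) fun p => p.2))
    (Counts.pow (Counts.var 3 (ha.reindex Sigma.fst) fun _ => rfl)
      (Counts.var 0 (FewBits.of_polyBdd hν) fun _ => rfl) hν))
    (Counts.pow (Counts.comp ((Runs.var 1).pair (Runs.const 0)) (counts_weightDen h))
      ((Counts.const d).sub (Counts.var 0 (FewBits.of_polyBdd hν) fun _ => rfl))
      ((PolyBdd.const d).mono fun p => Nat.sub_le _ _))

theorem counts_natCost (hΓ : PolyBdd N fun i => (Γ i).bits) (s : ∀ i, (Γ i).Profile)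
    (u : ∀ i, Fin (Γ i).n) :
    Counts N (Code.natCost d)
      (fun i => (Γ i).encode ∷ (Γ i).encodeProfile (s i) ∷ Data.atom (u i) ∷ Data.atom 0)
      fun i => (Γ i).natCost (u i) (s i) := by
  refine Counts.mul (Counts.comp ((Runs.var 0).pair ((Runs.var 2).pair (Runs.const 0)))
    (counts_natWeight hΓ u)) ?_
  refine Counts.sum (polyBdd_k hΓ) (counts_resources hΓ (Runs.var 0)).run ?_
  have h := hΓ.reindex (Sigma.fst : (Σ i, Fin (Γ i).k) → ι)
  have hl := counts_natLoad h (fun p => s p.1) fun p => p.2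
  exact Counts.ite (decides_mem (polyBdd_k h)
      (runs_strategy h (s := fun p => s p.1) (u := fun p => u p.1) (Runs.var 2) (Runs.var 3))
      (Runs.var 0))
    (Counts.comp ((Runs.var 1).pair ((Runs.var 0).pair ((Runs.comp ((Runs.var 1).pair
      ((Runs.var 2).pair ((Runs.var 0).pair (Runs.const 0)))) hl.run).pair (Runs.const 0))))
      (counts_natResourceCost h (fun p => p.2) hl.few))
    (Counts.const 0)

theorem runs_emptySet (hΓ : PolyBdd N fun i => (Γ i).bits)
    (hg : Runs N g x fun i => (Γ i).encode) :
    Runs N (Code.emptySet g) x fun i => Data.ofFinset (∅ : Finset (Fin (Γ i).k)) :=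
  (Runs.table (y := fun _ _ => Data.atom 0) (polyBdd_k hΓ) (counts_resources hΓ hg).run
    (Runs.const 0)).congr fun i => by
    simp [Data.ofFinset]

theorem runs_emptyState (hΓ : PolyBdd N fun i => (Γ i).bits)
    (hg : Runs N g x fun i => (Γ i).encode) :
    Runs N (Code.emptyState g) x fun i => (Γ i).encodeProfile (Γ i).emptyState :=
  Runs.table (polyBdd_n hΓ) (counts_players hΓ hg).run
    ((runs_emptySet hΓ hg).reindex Sigma.fst).wk

theorem runs_deviate (hΓ : PolyBdd N fun i => (Γ i).bits) (s : ∀ i, (Γ i).Profile)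
    (u : ∀ i, Fin (Γ i).n) (A : ∀ i, Finset (Fin (Γ i).k)) :
    Runs N Code.deviate (fun i => (Γ i).encode ∷ (Γ i).encodeProfile (s i) ∷ Data.atom (u i) ∷
      Data.ofFinset (A i) ∷ Data.atom 0)
      fun i => (Γ i).encodeProfile ((Γ i).deviate (s i) (u i) (A i)) := by
  refine Runs.table (polyBdd_n hΓ) (counts_players hΓ (Runs.var 0)).run ?_
  have h := hΓ.reindex (Sigma.fst : (Σ i, Fin (Γ i).n) → ι)
  refine Runs.ite (Decides.eq (Counts.var 0 (FewBits.fin (polyBdd_n h) fun p => p.2) fun _ => rfl)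
    (Counts.var 3 (FewBits.fin (polyBdd_n h) fun p => u p.1) fun _ => rfl))
    ((Runs.var 4).congr fun p => ?_) (Runs.congr (runs_strategy (h.reindex Subtype.val)
      (s := fun p => s p.1.1) (u := fun p => p.1.2) (Runs.var 2) (Runs.var 0)) fun p => ?_)
  · have e : p.1.2 = u p.1.1 := Fin.ext p.2
    simp [deviate, e, Data.dropEntries, Data.left, Data.right]
  · have e : p.1.2 ≠ u p.1.1 := fun h => p.2 (congrArg Fin.val h)
    simp [deviate, e]

theorem runs_others (hΓ : PolyBdd N fun i => (Γ i).bits) (s : ∀ i, (Γ i).Profile)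
    (u : ∀ i, Fin (Γ i).n) :
    Runs N Code.others (fun i => (Γ i).encode ∷ (Γ i).encodeProfile (s i) ∷ Data.atom (u i) ∷
      Data.atom 0) fun i => (Γ i).encodeProfile ((Γ i).others (s i) (u i)) :=
  Runs.comp ((Runs.var 0).pair ((Runs.var 1).pair ((Runs.var 2).pair
    ((runs_emptySet hΓ (Runs.var 0)).pair (Runs.const 0))))) (runs_deviate hΓ s u fun _ => ∅)

theorem size_ofFinset_le {k : ℕ} (A : Finset (Fin k)) : (Data.ofFinset A).size ≤ k * 3 + 1 := by
  refine (Data.size_ofList_le _ _ (b := 2) fun e _ => ?_).trans (by simp)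
  split_ifs <;> simp [Data.size]

/-- Apart from the game and a player, the input consists of `n * k` membership bits. Hence the time
bound `q` of the routine, taken at this size, is polynomial in `N`. -/
theorem polyBdd_brInput (hΓ : PolyBdd N fun i => (Γ i).bits) (s : ∀ i, (Γ i).Profile)
    (u : ∀ i, Fin (Γ i).n) : PolyBdd N fun i => ((Γ i).brInput (u i) (s i)).size := by
  have hn := polyBdd_n hΓ
  have h3 : PolyBdd N fun i => (Γ i).n * ((Γ i).k * 3 + 1 + 1) + 1 :=
    (hn.mul ((((polyBdd_k hΓ).mul (PolyBdd.const 3)).add (PolyBdd.const 1)).add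
      (PolyBdd.const 1))).add (PolyBdd.const 1)
  refine ((hΓ.add (((PolyBdd.add (FewBits.fin hn u) (PolyBdd.const 1)).add h3).add
    (PolyBdd.const 1))).add (PolyBdd.const 1)).mono fun i => ?_
  have := Data.size_ofList_le (fun v => Data.ofFinset ((Γ i).others (s i) (u i) v))
    (List.finRange (Γ i).n) fun v _ => size_ofFinset_le _
  rw [List.length_finRange] at this
  simp only [brInput, Data.size, encodeProfile, bits]
  omega

/-- The answers of the rules `br i` are computed by `B` in time `q`. -/
theorem runs_respond {B : Code} {q : Polynomial ℕ} {br : ∀ i, (Γ i).ResponseRule}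
    (hΓ : PolyBdd N fun i => (Γ i).bits) (hB : ∀ i, (Γ i).ComputesWithin B (br i) q)
    {s : ∀ i, (Γ i).Profile} (hs : ∀ i, s i ∈ (Γ i).states ∨ s i = (Γ i).emptyState)
    (u : ∀ i, Fin (Γ i).n) :
    Runs N (Code.respond B) (fun i => (Γ i).encode ∷ (Γ i).encodeProfile (s i) ∷
      Data.atom (u i) ∷ Data.atom 0)
      fun i => Data.ofFinset (br i (u i) ((Γ i).others (s i) (u i))) :=
  Runs.comp ((Runs.var 0).pair ((Runs.var 2).pair (runs_others hΓ s u)))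
    (Runs.of_le ((polyBdd_brInput hΓ s u).poly q) fun i => hB i (u i) (s i) (hs i))

/-- The profile after the best response of `u`. -/
def respondTo {d : ℕ} {Γ : Game d} (br : Γ.ResponseRule) (s : Γ.Profile) (u : Fin Γ.n) :
    Γ.Profile := Γ.deviate s u (br u (Γ.others s u))

theorem runs_bestMove {B : Code} {q : Polynomial ℕ} {br : ∀ i, (Γ i).ResponseRule}
    (hΓ : PolyBdd N fun i => (Γ i).bits) (hB : ∀ i, (Γ i).ComputesWithin B (br i) q)
    {s : ∀ i, (Γ i).Profile} (hs : ∀ i, s i ∈ (Γ i).states ∨ s i = (Γ i).emptyState)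
    (u : ∀ i, Fin (Γ i).n) :
    Runs N (Code.bestMove B) (fun i => (Γ i).encode ∷ (Γ i).encodeProfile (s i) ∷
      Data.atom (u i) ∷ Data.atom 0)
      fun i => (Γ i).encodeProfile (respondTo (br i) (s i) (u i)) :=
  Runs.comp ((Runs.var 0).pair ((Runs.var 1).pair ((Runs.var 2).pair
    ((runs_respond hΓ hB hs u).pair (Runs.const 0)))))
    (runs_deviate hΓ s u fun i => br i (u i) ((Γ i).others (s i) (u i)))

end Game

/-! ## The potential -/

/-- Multiply y^ν ≤ x^ν by y. -/
theorem sub_mul_pow_le {x y : ℚ} (hy : 0 ≤ y) (h : y ≤ x) (ν : ℕ) :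
    (x - y) * x ^ ν ≤ x * x ^ ν - y * y ^ ν := by
  have := mul_le_mul_of_nonneg_left (pow_le_pow_left₀ hy h ν) hy
  linarith

/-- The mean value estimate. The induction uses x^(ν+2) - y^(ν+2) = x(x^(ν+1) - y^(ν+1)) + (x -
y)y^(ν+1). -/
theorem mul_pow_sub_le {x y : ℚ} (hy : 0 ≤ y) (h : y ≤ x) (ν : ℕ) :
    x * x ^ ν - y * y ^ ν ≤ (ν + 1) * ((x - y) * x ^ ν) := by
  induction ν with
  | zero => simp
  | succ ν ih =>
    have h1 := mul_le_mul_of_nonneg_left ih (hy.trans h)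
    have h2 := mul_le_mul_of_nonneg_left
      (mul_le_mul (le_refl y) (pow_le_pow_left₀ hy h ν) (by positivity) hy) (sub_nonneg.2 h)
    have h3 : (x - y) * (y * x ^ ν) ≤ (x - y) * (x * x ^ ν) :=
      mul_le_mul_of_nonneg_left (mul_le_mul_of_nonneg_right h (pow_nonneg (hy.trans h) _))
        (sub_nonneg.2 h)
    push_cast
    rw [pow_succ', pow_succ']
    linarith

namespace Game

variable {d : ℕ} {Γ : Game d}

theorem resourceCost_nonneg (e : Fin Γ.k) {x : ℚ} (hx : 0 ≤ x) : 0 ≤ Γ.resourceCost e x :=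
  Finset.sum_nonneg fun ν _ => mul_nonneg (Γ.coeff_nonneg e ν) (pow_nonneg hx _)

theorem resourceCost_mono (e : Fin Γ.k) {x y : ℚ} (hy : 0 ≤ y) (h : y ≤ x) :
    Γ.resourceCost e y ≤ Γ.resourceCost e x :=
  Finset.sum_le_sum fun ν _ =>
    mul_le_mul_of_nonneg_left (pow_le_pow_left₀ hy h _) (Γ.coeff_nonneg e ν)

theorem load_nonneg (s : Γ.Profile) (e : Fin Γ.k) : 0 ≤ Γ.load s e :=
  Finset.sum_nonneg fun u _ => (Γ.weight_pos u).le

theorem cost_nonneg (u : Fin Γ.n) (s : Γ.Profile) : 0 ≤ Γ.cost u s :=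
  mul_nonneg (Γ.weight_pos u).le
    (Finset.sum_nonneg fun e _ => resourceCost_nonneg e (load_nonneg s e))

/-- The profile in which only the players in `F` use resources. -/
def restrict (s : Γ.Profile) (F : Finset (Fin Γ.n)) : Γ.Profile :=
  fun u => if u ∈ F then s u else ∅

/-- The total cost, an approximate potential. -/
def potential (s : Γ.Profile) : ℚ := ∑ e, Γ.load s e * Γ.resourceCost e (Γ.load s e)

theorem load_sub_load_restrict (s : Γ.Profile) (F : Finset (Fin Γ.n)) (e : Fin Γ.k) :
    Γ.load s e - Γ.load (restrict s F) e = ∑ u ∈ Fᶜ, if e ∈ s u then Γ.weight u else 0 := by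
  have h : Γ.load (restrict s F) e = ∑ u ∈ F, if e ∈ s u then Γ.weight u else 0 := by
    rw [load, Finset.sum_filter, ← Finset.sum_subset (Finset.subset_univ F)]
    · exact Finset.sum_congr rfl fun u hu => by simp [restrict, hu]
    · intro u _ hu
      simp [restrict, hu]
  rw [h, load, Finset.sum_filter, ← Finset.sum_add_sum_compl F]
  ring

theorem load_restrict_le (s : Γ.Profile) (F : Finset (Fin Γ.n)) (e : Fin Γ.k) :
    Γ.load (restrict s F) e ≤ Γ.load s e := by
  rw [← sub_nonneg, load_sub_load_restrict]
  exact Finset.sum_nonneg fun u _ => by split_ifs <;> simp [(Γ.weight_pos u).le]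

/-- Exchange the sums over players and resources: the players outside `F` on a resource carry
exactly the difference of the loads. -/
theorem sum_cost_compl (s : Γ.Profile) (F : Finset (Fin Γ.n)) :
    ∑ u ∈ Fᶜ, Γ.cost u s =
      ∑ e, (Γ.load s e - Γ.load (restrict s F) e) * Γ.resourceCost e (Γ.load s e) := by
  simp only [load_sub_load_restrict, Finset.sum_mul]
  rw [Finset.sum_comm]
  refine Finset.sum_congr rfl fun u _ => ?_
  rw [cost, Finset.mul_sum]
  simp only [ite_mul, zero_mul]
  rw [← Finset.sum_filter]
  simp

theorem sum_cost_compl_le (s : Γ.Profile) (F : Finset (Fin Γ.n)) :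
    ∑ u ∈ Fᶜ, Γ.cost u s ≤ potential s - potential (restrict s F) := by
  rw [sum_cost_compl, potential, potential, ← Finset.sum_sub_distrib]
  refine Finset.sum_le_sum fun e _ => ?_
  simp only [resourceCost, Finset.mul_sum]
  rw [← Finset.sum_sub_distrib]
  refine Finset.sum_le_sum fun ν _ => ?_
  have := mul_le_mul_of_nonneg_left (sub_mul_pow_le (load_nonneg (restrict s F) e)
    (load_restrict_le s F e) ν) (Γ.coeff_nonneg e ν)
  linarith

/-- The factor `d + 1` is the largest `ν + 1` in `mul_pow_sub_le`, applied to each monomial; the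
coefficients are nonnegative. -/
theorem le_sum_cost_compl (s : Γ.Profile) (F : Finset (Fin Γ.n)) :
    potential s - potential (restrict s F) ≤ (d + 1) * ∑ u ∈ Fᶜ, Γ.cost u s := by
  rw [sum_cost_compl, potential, potential, ← Finset.sum_sub_distrib, Finset.mul_sum]
  refine Finset.sum_le_sum fun e _ => ?_
  simp only [resourceCost, Finset.mul_sum]
  rw [← Finset.sum_sub_distrib]
  refine Finset.sum_le_sum fun ν _ => ?_
  have h0 := load_nonneg (restrict s F) e
  have h1 := load_restrict_le s F e
  have h2 := mul_le_mul_of_nonneg_left (mul_pow_sub_le h0 h1 ν) (Γ.coeff_nonneg e ν)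
  have h3 : (ν : ℚ) ≤ d := by exact_mod_cast Nat.lt_succ_iff.1 ν.2
  have h4 : 0 ≤ Γ.coeff e ν * ((Γ.load s e - Γ.load (restrict s F) e) * Γ.load s e ^ (ν : ℕ)) :=
    mul_nonneg (Γ.coeff_nonneg e ν) (mul_nonneg (sub_nonneg.2 h1) (pow_nonneg (h0.trans h1) _))
  have h5 := mul_le_mul_of_nonneg_right h3 h4
  linarith

theorem potential_restrict_le (s : Γ.Profile) (F : Finset (Fin Γ.n)) :
    potential (restrict s F) ≤ potential s := by
  have := (Finset.sum_nonneg fun u _ => cost_nonneg u s).trans (sum_cost_compl_le s F)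
  linarith

/-- This keeps the term subtracted from the potential constant while only players outside `F` move.
-/
theorem restrict_deviate (s : Γ.Profile) {u : Fin Γ.n} (A : Finset (Fin Γ.k))
    {F : Finset (Fin Γ.n)} (hu : u ∉ F) : restrict (Γ.deviate s u A) F = restrict s F := by
  ext1 v
  unfold restrict
  split_ifs with h
  · rw [deviate, Function.update_of_ne (ne_of_mem_of_not_mem h hu)]
  · rfl

/-- With everybody but `u` in `F`, the restricted profile is the same before and after the move. The
lower estimate is used before it and the upper one after it. -/
theorem potential_deviate_le (s : Γ.Profile) (u : Fin Γ.n) (A : Finset (Fin Γ.k)) :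
    potential (Γ.deviate s u A) + Γ.cost u s ≤
      potential s + (d + 1) * Γ.cost u (Γ.deviate s u A) := by
  have h1 := le_sum_cost_compl (Γ.deviate s u A) {u}ᶜ
  have h2 := sum_cost_compl_le s {u}ᶜ
  rw [restrict_deviate s A (by simp), compl_compl, Finset.sum_singleton] at h1
  rw [compl_compl, Finset.sum_singleton] at h2
  linarith

/-- The denominator `α p + 1` of the relative decrease of the potential in a move. -/
def decreaseDen (d : ℕ) : ℕ := alpha d * target d + 1

theorem target_pos (hd : 1 ≤ d) : 0 < target d := by
  unfold target
  positivity

theorem HasMove.respond {br : Γ.ResponseRule} {s : Γ.Profile} {u : Fin Γ.n} {ρ : ℚ} (hρ : 0 ≤ ρ)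
    (hA : Γ.IsBestResponse u s (br u (Γ.others s u))) (h : Γ.HasMove ρ u s) :
    ρ * Γ.cost u (respondTo br s u) < Γ.cost u s := by
  obtain ⟨A, hA', h⟩ := h
  exact (mul_le_mul_of_nonneg_left (hA.2 A hA') hρ).trans_lt h

/-- Hence every `p`-move is also an (α + 1/p)-move, and one estimate of the decrease serves both
kinds. -/
theorem lowFactor_le_target (hd : 1 ≤ d) : lowFactor d ≤ target d := by
  have h1 : (1 : ℚ) ≤ target d := by exact_mod_cast target_pos hd
  have h2 : (1 : ℚ) / target d ≤ 1 := by
    rw [div_le_one (by linarith)]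
    exact h1
  have h3 : alpha d + 1 ≤ target d := by
    have h4 : 1 ≤ (4 * d) ^ (d + 1) := Nat.one_le_pow _ _ (by omega)
    have h5 : (2 * d + 3) * (d + 1) * 1 ≤ target d := Nat.mul_le_mul_left _ h4
    unfold alpha
    nlinarith
  have h4 : (alpha d : ℚ) + 1 ≤ target d := by exact_mod_cast h3
  unfold lowFactor
  linarith

/-- The new cost is less than C/(α + 1/p), where C is the old one, so the decrease C - αC' is at
least C(1 - αp/(αp + 1)) = C/(αp + 1). -/
theorem potential_respondTo_le (hd : 1 ≤ d) {br : Γ.ResponseRule} {s : Γ.Profile} {u : Fin Γ.n}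
    (hA : Γ.IsBestResponse u s (br u (Γ.others s u))) (h : Γ.HasMove (lowFactor d) u s) :
    potential (respondTo br s u) + Γ.cost u s / decreaseDen d ≤ potential s := by
  have hp : (0 : ℚ) < target d := by exact_mod_cast target_pos hd
  have ha : (0 : ℚ) ≤ alpha d := Nat.cast_nonneg _
  have h1 := h.respond (by unfold lowFactor; positivity) hA
  have h2 := potential_deviate_le s u (br u (Γ.others s u))
  change potential (respondTo br s u) + _ ≤ _ + _ * Γ.cost u (respondTo br s u) at h2
  have hD : (decreaseDen d : ℚ) = alpha d * target d + 1 := by simp [decreaseDen]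
  -- Here p(α + 1/p) = αp + 1.
  have h3 : (decreaseDen d : ℚ) * Γ.cost u (respondTo br s u) ≤ target d * Γ.cost u s := by
    have := (mul_lt_mul_of_pos_left h1 hp).le
    refine le_trans (le_of_eq ?_) this
    rw [hD, lowFactor]
    field_simp
  have hD0 : (0 : ℚ) < decreaseDen d := by
    rw [hD]
    positivity
  have h4 : Γ.cost u s / decreaseDen d ≤ Γ.cost u s - alpha d * Γ.cost u (respondTo br s u) := by
    rw [div_le_iff₀ hD0]
    have := mul_le_mul_of_nonneg_left h3 ha
    rw [hD] at this ⊢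
    linarith
  have h5 : (alpha d : ℚ) = d + 1 := by simp [alpha]
  rw [h5] at h4
  linarith

/-! ## Counting moves -/

theorem respondTo_mem {br : Γ.ResponseRule} (hbr : Γ.IsBestResponseRule br) {s : Γ.Profile}
    (hs : s ∈ Γ.states) (u : Fin Γ.n) : respondTo br s u ∈ Γ.states := by
  intro v
  by_cases h : v = u
  · subst h
    simpa [respondTo, deviate] using (hbr v s (Or.inl hs)).1
  · simpa [respondTo, deviate, h] using hs v

/-- Removing the other players can only lower the loads and hence the cost, and a player alone has
positive cost. -/
theorem cost_pos (hpos : Γ.PositiveCosts) {s : Γ.Profile} (hs : s ∈ Γ.states) (u : Fin Γ.n) :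
    0 < Γ.cost u s := by
  refine (hpos u (s u) (hs u)).trans_le ?_
  have h : Γ.deviate Γ.emptyState u (s u) = restrict s {u} := by
    ext1 v
    by_cases h : v = u
    · subst h
      simp [deviate, restrict]
    · simp [deviate, restrict, h, emptyState]
  rw [h, cost, cost]
  refine mul_le_mul_of_nonneg_left ?_ (Γ.weight_pos u).le
  simp only [restrict, Finset.mem_singleton, if_true]
  exact Finset.sum_le_sum fun e _ =>
    resourceCost_mono e (load_nonneg _ e) (load_restrict_le s {u} e)

theorem cMax_pos (hpos : Γ.PositiveCosts) {s : Γ.Profile} (hs : s ∈ Γ.states) :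
    0 < Γ.cMax s :=
  (cost_pos hpos hs ⟨0, Γ.n_pos⟩).trans_le
    (Finset.le_sup' (fun u => Γ.cost u s) (Finset.mem_univ _))

/-- A bound on the number of moves in a phase. -/
def moveBound (br : Γ.ResponseRule) (s₀ : Γ.Profile) : ℕ :=
  (d + 1) * Γ.n * Γ.ratio br s₀ ^ 2 * decreaseDen d

/-- What holds for a configuration reached by `j` moves of the current phase. -/
structure Invariant (br : Γ.ResponseRule) (s₀ : Γ.Profile) (c : Γ.Config) (j : ℕ) : Prop where
  state_mem : c.state ∈ Γ.states
  phase_le : c.phase ≤ Γ.numPhases br s₀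
  at_end : c.phase = Γ.numPhases br s₀ → j = 0
  fixed_eq : c.phase = 0 → c.fixed = ∅
  -- The budget of the phase: what is left of the potential above that of the fixed players, plus
  -- the guaranteed decrease of `j` moves, stays below the bound valid at the start. The truncated
  -- index `c.phase - 1` is `0` in both phases 0 and 1.
  gap : c.phase < Γ.numPhases br s₀ → potential c.state - potential (restrict c.state c.fixed) +
    j * (Γ.boundary br s₀ (c.phase + 1) / decreaseDen d) ≤
      (d + 1) * (Γ.n * Γ.boundary br s₀ (c.phase - 1))

section Run

variable {br : Γ.ResponseRule} {s₀ : Γ.Profile}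

theorem numPhases_pos : 0 < Γ.numPhases br s₀ := by simp [numPhases]

theorem ratio_pos : (1 : ℚ) ≤ Γ.ratio br s₀ := by
  unfold ratio
  exact_mod_cast Nat.le_add_left _ _

theorem boundary_succ (i : ℕ) :
    Γ.boundary br s₀ i = Γ.ratio br s₀ * Γ.boundary br s₀ (i + 1) := by
  have := ratio_pos (br := br) (s₀ := s₀)
  unfold boundary
  field_simp
  ring

theorem boundary_pos (h : 0 < Γ.cMax s₀) (i : ℕ) : 0 < Γ.boundary br s₀ i := by
  have := ratio_pos (br := br) (s₀ := s₀)
  unfold boundary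
  positivity

theorem boundary_succ_le (h : 0 < Γ.cMax s₀) (i : ℕ) :
    Γ.boundary br s₀ (i + 1) ≤ Γ.boundary br s₀ i := by
  rw [boundary_succ i]
  exact le_mul_of_one_le_left (boundary_pos h _).le ratio_pos

theorem decreaseDen_pos : (0 : ℚ) < decreaseDen d := by
  unfold decreaseDen
  positivity

/-- The difference of potentials in `gap` is nonnegative, so the decrease already made is at most
the budget; dividing by the positive boundary leaves a bound for `j`. -/
theorem Invariant.le_moveBound (h0 : 0 < Γ.cMax s₀) {c : Γ.Config} {j : ℕ}
    (h : Invariant br s₀ c j) : j ≤ moveBound br s₀ := by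
  rcases h.phase_le.eq_or_lt with he | hl
  · simp [h.at_end he]
  have h1 := h.gap hl
  have h2 := potential_restrict_le c.state c.fixed
  have hb := boundary_pos (br := br) h0 (c.phase + 1)
  have hg := ratio_pos (br := br) (s₀ := s₀)
  -- An equality for phases at least 1. In phase 0 the left side is b_0 = g b_1, and g ≥ 1 supplies
  -- the second factor.
  have h3 : Γ.boundary br s₀ (c.phase - 1) ≤
      (Γ.ratio br s₀ : ℚ) ^ 2 * Γ.boundary br s₀ (c.phase + 1) := by
    rcases Nat.eq_zero_or_pos c.phase with h | h
    · rw [h, Nat.zero_sub, boundary_succ 0, sq, mul_assoc]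
      refine le_mul_of_one_le_left ?_ hg
      exact mul_nonneg (by linarith) (boundary_pos h0 _).le
    · obtain ⟨i, hi⟩ := Nat.exists_eq_add_of_lt h
      rw [hi, Nat.zero_add, Nat.add_sub_cancel, boundary_succ i, boundary_succ (i + 1), sq,
        mul_assoc]
  have h4 : (j : ℚ) * (Γ.boundary br s₀ (c.phase + 1) / decreaseDen d) ≤
      (d + 1) * (Γ.n * ((Γ.ratio br s₀ : ℚ) ^ 2 * Γ.boundary br s₀ (c.phase + 1))) := by
    refine le_trans (by linarith) (h1.trans ?_)
    gcongr
  have hD := decreaseDen_pos (d := d)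
  rw [mul_div_assoc', div_le_iff₀ hD] at h4
  have h5 : (j : ℚ) ≤ (d + 1) * Γ.n * (Γ.ratio br s₀ : ℚ) ^ 2 * decreaseDen d := by
    refine le_of_mul_le_mul_right ?_ hb
    linarith
  unfold moveBound
  exact_mod_cast h5

theorem invariant_init (hs : s₀ ∈ Γ.states) : Invariant br s₀ ⟨0, ∅, s₀⟩ 0 where
  state_mem := hs
  phase_le := Nat.zero_le _
  at_end _ := rfl
  fixed_eq _ := rfl
  gap _ := by
    have h1 := le_sum_cost_compl s₀ ∅
    have h2 : ∑ u ∈ (∅ : Finset (Fin Γ.n))ᶜ, Γ.cost u s₀ ≤ Γ.n * Γ.boundary br s₀ 0 := by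
      have := Finset.sum_le_card_nsmul (Finset.univ : Finset (Fin Γ.n)) (fun u => Γ.cost u s₀)
        (Γ.cMax s₀) fun u hu => Finset.le_sup' (fun u => Γ.cost u s₀) hu
      simpa [boundary] using this
    have h3 : (d + 1 : ℚ) * ∑ u ∈ (∅ : Finset (Fin Γ.n))ᶜ, Γ.cost u s₀ ≤
      (d + 1) * (Γ.n * Γ.boundary br s₀ 0) := by gcongr
    simpa using h1.trans h3

theorem Eligible.phase_lt {c : Γ.Config} {u : Fin Γ.n} (h : Eligible br s₀ c u) :
    c.phase < Γ.numPhases br s₀ := by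
  rcases h with h | h
  · rw [h.1]
    exact numPhases_pos
  · exact h.2.1

theorem Invariant.move (hd : 1 ≤ d) (hbr : Γ.IsBestResponseRule br) (h0 : 0 < Γ.cMax s₀)
    {c : Γ.Config} {j : ℕ} (h : Invariant br s₀ c j) {u : Fin Γ.n} (hu : Eligible br s₀ c u) :
    Invariant br s₀ (c.move br u) (j + 1) where
  state_mem := respondTo_mem hbr h.state_mem u
  phase_le := h.phase_le
  at_end e := absurd e hu.phase_lt.ne
  fixed_eq := h.fixed_eq
  gap hl := by
    have h1 := h.gap hl
    have hb := boundary_succ_le (br := br) h0 c.phase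
    -- Whichever clause admits the player, she is not fixed, her cost is at least b_{i+1} and she
    -- has an (α + 1/p)-move.
    obtain ⟨hf, hc, hm⟩ : u ∉ c.fixed ∧ Γ.boundary br s₀ (c.phase + 1) ≤ Γ.cost u c.state ∧
        Γ.HasMove (lowFactor d) u c.state := by
      rcases hu with ⟨hi, hc, hm⟩ | ⟨hi, -, hf, ⟨hc, -, hm⟩ | ⟨hc, A, hA, hm⟩⟩
      · exact ⟨by simp [h.fixed_eq hi], by rwa [hi], hm⟩
      · exact ⟨hf, hc, hm⟩
      · exact ⟨hf, hb.trans hc, A, hA, (mul_le_mul_of_nonneg_right (lowFactor_le_target hd)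
          (cost_nonneg _ _)).trans_lt hm⟩
    have h2 := potential_respondTo_le hd (hbr u c.state (Or.inl h.state_mem)) hm
    have h3 : Γ.boundary br s₀ (c.phase + 1) / decreaseDen d ≤ Γ.cost u c.state / decreaseDen d :=
      div_le_div_of_nonneg_right hc decreaseDen_pos.le
    change potential (respondTo br c.state u) - potential (restrict (respondTo br c.state u) c.fixed)
      + ((j + 1 : ℕ) : ℚ) * (Γ.boundary br s₀ (c.phase + 1) / decreaseDen d) ≤
      (d + 1) * (Γ.n * Γ.boundary br s₀ (c.phase - 1))
    rw [respondTo, restrict_deviate _ _ hf, ← respondTo]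
    push_cast
    linarith

theorem Invariant.close (h0 : 0 < Γ.cMax s₀)
    {c : Γ.Config} {j : ℕ} (h : Invariant br s₀ c j) (hc : c.phase < Γ.numPhases br s₀) :
    Invariant br s₀ (c.close br s₀) 0 where
  state_mem := h.state_mem
  phase_le := hc
  at_end _ := rfl
  fixed_eq e := absurd e (Nat.succ_ne_zero _)
  gap hl := by
    change c.phase + 1 < Γ.numPhases br s₀ at hl
    have hF : (c.close br s₀).fixed =
        c.fixed ∪ if c.phase = 0 then ∅ else costly br s₀ c.state c.phase := by
      simp [Config.close, hl]
    have hst : (c.close br s₀).state = c.state := rfl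
    have hph : (c.close br s₀).phase - 1 = c.phase := rfl
    rw [hF, hst, hph, Nat.cast_zero, zero_mul, add_zero]
    split_ifs with hi
    -- Phase 0 fixes nobody and never raises the potential, so the budget (d + 1) n b_0 carries over
    -- to phase 1.
    · have h1 := h.gap hc
      have h2 : 0 ≤ (j : ℚ) * (Γ.boundary br s₀ (c.phase + 1) / decreaseDen d) :=
        mul_nonneg (Nat.cast_nonneg _) (div_nonneg (boundary_pos h0 _).le decreaseDen_pos.le)
      rw [hi] at h1 h2 ⊢
      rw [Finset.union_empty]
      simp only [Nat.zero_sub] at h1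
      linarith
    -- All players with cost at least b_i have just been fixed, so each of the others pays less than
    -- b_i, the boundary demanded for phase i + 1.
    · refine (le_sum_cost_compl _ _).trans ?_
      have h1 : ∑ u ∈ (c.fixed ∪ costly br s₀ c.state c.phase)ᶜ, Γ.cost u c.state ≤
          Γ.n * Γ.boundary br s₀ c.phase := by
        refine (Finset.sum_le_card_nsmul _ _ (Γ.boundary br s₀ c.phase) fun u hu => ?_).trans ?_
        · simp only [costly, Finset.mem_compl, Finset.mem_union, Finset.mem_filter,
            Finset.mem_univ, true_and, not_or, not_le] at hu
          exact hu.2.le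
        · rw [nsmul_eq_mul]
          refine mul_le_mul_of_nonneg_right ?_ (boundary_pos h0 _).le
          exact_mod_cast (Finset.card_le_univ _).trans (by simp)
      gcongr

theorem Invariant.step (hd : 1 ≤ d) (hbr : Γ.IsBestResponseRule br) (h0 : 0 < Γ.cMax s₀)
    {c c' : Γ.Config} {j : ℕ} (h : Invariant br s₀ c j) (hs : Step br s₀ c c') :
    (c'.phase = c.phase ∧ c.phase < Γ.numPhases br s₀ ∧ Invariant br s₀ c' (j + 1)) ∨
      (c'.phase = c.phase + 1 ∧ c.phase < Γ.numPhases br s₀ ∧ Invariant br s₀ c' 0) := by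
  cases hs with
  | move u hu => exact Or.inl ⟨rfl, hu.phase_lt, h.move hd hbr h0 hu⟩
  | close hl hn => exact Or.inr ⟨rfl, hl, h.close h0 hl⟩

/-- Phases never decrease. The induction needs all three cases: a past phase does not recur, the
current one has already consumed `j` moves, and a future one starts with a fresh budget. The
additional 1 is the configuration before the first move of the phase. -/
theorem Invariant.countP_le (hd : 1 ≤ d) (hbr : Γ.IsBestResponseRule br) (h0 : 0 < Γ.cMax s₀)
    {L : List Γ.Config} {c : Γ.Config} {j : ℕ} (h : Invariant br s₀ c j)
    (hL : (c :: L).IsChain (Step br s₀)) (i : ℕ) :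
    (i < c.phase → (c :: L).countP (fun c => c.phase = i) = 0) ∧
      (c.phase = i → j + (c :: L).countP (fun c => c.phase = i) ≤ moveBound br s₀ + 1) ∧
      (c :: L).countP (fun c => c.phase = i) ≤ moveBound br s₀ + 1 := by
  induction L generalizing c j with
  | nil =>
    have := h.le_moveBound h0
    rw [List.countP_singleton]
    split_ifs with e <;> simp only [decide_eq_true_eq] at e <;> omega
  | cons c' L ih =>
    rw [List.isChain_cons_cons] at hL
    have hj := h.le_moveBound h0
    rw [List.countP_cons]
    rcases h.step hd hbr h0 hL.1 with ⟨hp, hl, h'⟩ | ⟨hp, hl, h'⟩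
    · have := ih h' hL.2
      split_ifs with e <;> simp only [decide_eq_true_eq] at e <;> omega
    · have := ih h' hL.2
      split_ifs with e <;> simp only [decide_eq_true_eq] at e <;> omega

/-- Each remaining phase has at most `moveBound + 1` configurations, of which the current one has
already spent `j`; the last 1 is the final configuration. -/
theorem Invariant.length_le (hd : 1 ≤ d) (hbr : Γ.IsBestResponseRule br) (h0 : 0 < Γ.cMax s₀)
    {L : List Γ.Config} {c : Γ.Config} {j : ℕ} (h : Invariant br s₀ c j)
    (hL : (c :: L).IsChain (Step br s₀)) :
    (c :: L).length + j ≤ (Γ.numPhases br s₀ - c.phase) * (moveBound br s₀ + 1) + 1 := by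
  induction L generalizing c j with
  | nil =>
    rcases h.phase_le.eq_or_lt with he | hl
    · simp [h.at_end he]
    · have h1 := h.le_moveBound h0
      have h2 := Nat.mul_le_mul_right (moveBound br s₀ + 1) (Nat.sub_pos_of_lt hl)
      rw [List.length_singleton]
      omega
  | cons c' L ih =>
    rw [List.isChain_cons_cons] at hL
    have hj := h.le_moveBound h0
    rcases h.step hd hbr h0 hL.1 with ⟨hp, hl, h'⟩ | ⟨hp, hl, h'⟩
    · have := ih h' hL.2
      rw [hp] at this
      rw [List.length_cons]
      omega
    · have := ih h' hL.2
      have e : Γ.numPhases br s₀ - c.phase = Γ.numPhases br s₀ - c'.phase + 1 := by omega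
      rw [List.length_cons, e, add_mul]
      omega

theorem movesInPhase_le (hd : 1 ≤ d) (hbr : Γ.IsBestResponseRule br) (hpos : Γ.PositiveCosts)
    (hs : s₀ ∈ Γ.states) {L : List Γ.Config} (hL : IsPartialRun br s₀ L) (i : ℕ) :
    movesInPhase L i ≤ moveBound br s₀ := by
  obtain ⟨h1, h2⟩ := hL
  cases L with
  | nil => simp at h1
  | cons c L =>
    obtain rfl : c = ⟨0, ∅, s₀⟩ := by simpa using h1
    have := ((invariant_init hs).countP_le hd hbr (cMax_pos hpos hs) h2 i).2.2
    unfold movesInPhase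
    omega

theorem length_le_of_isPartialRun (hd : 1 ≤ d) (hbr : Γ.IsBestResponseRule br)
    (hpos : Γ.PositiveCosts) (hs : s₀ ∈ Γ.states) {L : List Γ.Config}
    (hL : IsPartialRun br s₀ L) :
    L.length ≤ Γ.numPhases br s₀ * (moveBound br s₀ + 1) + 1 := by
  obtain ⟨h1, h2⟩ := hL
  cases L with
  | nil => simp at h1
  | cons c L =>
    obtain rfl : c = ⟨0, ∅, s₀⟩ := by simpa using h1
    exact (invariant_init hs).length_le hd hbr (cMax_pos hpos hs) h2

end Run

end Game

namespace Game

/-! ## The parameters of the algorithm -/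

section Parameters

variable {d : ℕ} {Γ : Game d}

def natMax (Γ : Game d) (s : Γ.Profile) : ℕ := Finset.univ.sup fun u => Γ.natCost u s

/-- The cost of a player who best-responds to the empty state, multiplied by `Γ.scale`. -/
def natAlone (br : Γ.ResponseRule) (u : Fin Γ.n) : ℕ := Γ.natCost u (respondTo br Γ.emptyState u)

/-- With Σ the sum of all values, the minimum equals Σ - max (Σ - a_u). In this form it is computed
by sum and maximum loops, which start from zero. -/
def natMin (br : Γ.ResponseRule) : ℕ :=
  (∑ u, natAlone br u) - Finset.univ.sup fun u => (∑ v, natAlone br v) - natAlone br u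

theorem natMax_eq (s : Γ.Profile) : (Γ.natMax s : ℚ) = Γ.scale * Γ.cMax s := by
  have hs : (0 : ℚ) < Γ.scale := by exact_mod_cast Γ.scale_pos
  apply le_antisymm
  · obtain ⟨u, -, hu⟩ := Finset.exists_mem_eq_sup _ Γ.univ_nonempty fun u => Γ.natCost u s
    rw [natMax, hu, natCost_eq]
    exact mul_le_mul_of_nonneg_left (Finset.le_sup' (fun u => Γ.cost u s) (Finset.mem_univ u)) hs.le
  · obtain ⟨u, -, hu⟩ := Finset.exists_mem_eq_sup' Γ.univ_nonempty fun u => Γ.cost u s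
    rw [cMax, hu, ← natCost_eq]
    exact_mod_cast Finset.le_sup (f := fun u => Γ.natCost u s) (Finset.mem_univ u)

theorem natMin_eq (br : Γ.ResponseRule) : (natMin br : ℚ) = Γ.scale * Γ.cMin br := by
  have hs : (0 : ℚ) < Γ.scale := by exact_mod_cast Γ.scale_pos
  have hle : ∀ u, natAlone br u ≤ ∑ v, natAlone br v := fun u =>
    Finset.single_le_sum (f := natAlone br) (fun _ _ => Nat.zero_le _) (Finset.mem_univ u)
  apply le_antisymm
  · obtain ⟨u, -, hu⟩ := Finset.exists_mem_eq_inf' Γ.univ_nonempty fun u =>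
      Γ.cost u (Γ.deviate Γ.emptyState u (br u (Γ.others Γ.emptyState u)))
    rw [cMin, hu, ← natCost_eq]
    have h := Finset.le_sup (f := fun u => (∑ v, natAlone br v) - natAlone br u)
      (Finset.mem_univ u)
    have h' := hle u
    have : natMin br ≤ natAlone br u := by
      unfold natMin
      omega
    exact_mod_cast this
  · obtain ⟨u, -, hu⟩ := Finset.exists_mem_eq_sup _ Γ.univ_nonempty fun u =>
      (∑ v, natAlone br v) - natAlone br u
    have h' := hle u
    have : natMin br = natAlone br u := by
      unfold natMin
      omega
    rw [this, natAlone, natCost_eq]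
    exact mul_le_mul_of_nonneg_left (Finset.inf'_le (fun u =>
      Γ.cost u (Γ.deviate Γ.emptyState u (br u (Γ.others Γ.emptyState u)))) (Finset.mem_univ u))
      hs.le

theorem natMin_pos {br : Γ.ResponseRule} (hbr : Γ.IsBestResponseRule br)
    (hpos : Γ.PositiveCosts) : 0 < natMin br := by
  have hs : (0 : ℚ) < Γ.scale := by exact_mod_cast Γ.scale_pos
  have : (0 : ℚ) < natMin br := by
    rw [natMin_eq]
    refine mul_pos hs ((Finset.lt_inf'_iff _).2 fun u _ => hpos u _ ?_)
    exact (hbr u Γ.emptyState (Or.inr rfl)).1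
  exact_mod_cast this

/-- The ceiling and the logarithm disappear because 2^j is a natural number, and the division
because `natMin` is positive. This makes `logRatio` computable by repeated doubling. -/
theorem logRatio_le_iff {br : Γ.ResponseRule} (hbr : Γ.IsBestResponseRule br)
    (hpos : Γ.PositiveCosts) (s : Γ.Profile) (j : ℕ) :
    Γ.logRatio br s ≤ j ↔ Γ.natMax s ≤ natMin br * 2 ^ j := by
  have hs : (0 : ℚ) < Γ.scale := by exact_mod_cast Γ.scale_pos
  have hm : (0 : ℚ) < natMin br := by exact_mod_cast natMin_pos hbr hpos
  rw [natMin_eq] at hm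
  have hm' : 0 < Γ.cMin br := (mul_pos_iff_of_pos_left hs).1 hm
  rw [logRatio, Nat.clog_le_iff_le_pow (by norm_num), Nat.ceil_le, div_le_iff₀ hm',
    ← Nat.cast_le (α := ℚ) (m := Γ.natMax s), Nat.cast_mul, natMax_eq, natMin_eq, mul_assoc,
    mul_le_mul_iff_right₀ hs, mul_comm, Nat.cast_pow]

/-- A positive natural number `natMin` is at least 1, so 2 to the bit length of `natMax` suffices.
-/
theorem logRatio_le_size {br : Γ.ResponseRule} (hbr : Γ.IsBestResponseRule br)
    (hpos : Γ.PositiveCosts) (s : Γ.Profile) : Γ.logRatio br s ≤ Nat.size (Γ.natMax s) := by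
  rw [logRatio_le_iff hbr hpos]
  exact (Nat.lt_size_self _).le.trans (Nat.le_mul_of_pos_left _ (natMin_pos hbr hpos))

theorem boundary_le_cost_iff (br : Γ.ResponseRule) (s₀ s : Γ.Profile) (u : Fin Γ.n) (i : ℕ) :
    Γ.boundary br s₀ i ≤ Γ.cost u s ↔ Γ.natMax s₀ ≤ Γ.natCost u s * Γ.ratio br s₀ ^ i := by
  have hs : (0 : ℚ) < Γ.scale := by exact_mod_cast Γ.scale_pos
  have hg : (0 : ℚ) < (Γ.ratio br s₀ : ℚ) ^ i :=
    pow_pos (zero_lt_one.trans_le (ratio_pos (br := br) (s₀ := s₀))) i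
  rw [boundary, div_le_iff₀ hg, ← Nat.cast_le (α := ℚ), Nat.cast_mul, natMax_eq, natCost_eq,
    mul_assoc, mul_le_mul_iff_right₀ hs, Nat.cast_pow]

/-- If any strategy witnesses the move then so does the best response, so one call of the routine
decides the question. -/
theorem hasMove_iff {br : Γ.ResponseRule} {s : Γ.Profile} {u : Fin Γ.n} {ρ : ℚ} (hρ : 0 ≤ ρ)
    (hA : Γ.IsBestResponse u s (br u (Γ.others s u))) :
    Γ.HasMove ρ u s ↔ ρ * Γ.natCost u (respondTo br s u) < Γ.natCost u s := by
  have hs : (0 : ℚ) < Γ.scale := by exact_mod_cast Γ.scale_pos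
  rw [natCost_eq, natCost_eq, mul_left_comm, mul_lt_mul_iff_right₀ hs]
  exact ⟨fun h => h.respond hρ hA, fun h => ⟨_, hA.1, h⟩⟩

theorem hasMove_lowFactor_iff (hd : 1 ≤ d) {br : Γ.ResponseRule} {s : Γ.Profile} {u : Fin Γ.n}
    (hA : Γ.IsBestResponse u s (br u (Γ.others s u))) :
    Γ.HasMove (lowFactor d) u s ↔
      decreaseDen d * Γ.natCost u (respondTo br s u) < target d * Γ.natCost u s := by
  have hp : (0 : ℚ) < target d := by exact_mod_cast target_pos hd
  rw [hasMove_iff (by unfold lowFactor; positivity) hA, ← mul_lt_mul_iff_right₀ hp, ← mul_assoc,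
    ← Nat.cast_lt (α := ℚ)]
  have : (target d : ℚ) * lowFactor d = decreaseDen d := by
    simp only [lowFactor, decreaseDen, Nat.cast_add, Nat.cast_mul, Nat.cast_one]
    field_simp
  rw [this, Nat.cast_mul, Nat.cast_mul]

theorem hasMove_target_iff {br : Γ.ResponseRule} {s : Γ.Profile} {u : Fin Γ.n}
    (hA : Γ.IsBestResponse u s (br u (Γ.others s u))) :
    Γ.HasMove (target d) u s ↔
      target d * Γ.natCost u (respondTo br s u) < Γ.natCost u s := by
  rw [hasMove_iff (Nat.cast_nonneg _) hA]
  exact_mod_cast Iff.rfl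

/-- Every clause is now a comparison of natural numbers that the machine can evaluate. -/
theorem eligible_iff (hd : 1 ≤ d) {br : Γ.ResponseRule} (hbr : Γ.IsBestResponseRule br)
    {s₀ : Γ.Profile} {c : Γ.Config} (hc : c.state ∈ Γ.states) (u : Fin Γ.n) :
    Eligible br s₀ c u ↔
      (c.phase = 0 ∧ Γ.natMax s₀ ≤ Γ.natCost u c.state * Γ.ratio br s₀ ^ 1 ∧
        decreaseDen d * Γ.natCost u (respondTo br c.state u) < target d * Γ.natCost u c.state) ∨
      (1 ≤ c.phase ∧ c.phase < Γ.numPhases br s₀ ∧ u ∉ c.fixed ∧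
        ((Γ.natMax s₀ ≤ Γ.natCost u c.state * Γ.ratio br s₀ ^ (c.phase + 1) ∧
          ¬ Γ.natMax s₀ ≤ Γ.natCost u c.state * Γ.ratio br s₀ ^ c.phase ∧
          decreaseDen d * Γ.natCost u (respondTo br c.state u) <
            target d * Γ.natCost u c.state) ∨
        (Γ.natMax s₀ ≤ Γ.natCost u c.state * Γ.ratio br s₀ ^ c.phase ∧
          target d * Γ.natCost u (respondTo br c.state u) < Γ.natCost u c.state))) := by
  have hA := hbr u c.state (Or.inl hc)
  unfold Eligible
  simp only [hasMove_lowFactor_iff hd hA, hasMove_target_iff hA, boundary_le_cost_iff, ← not_le]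

end Parameters

end Game

/-! ## Programs for the parameters -/

namespace Code

/-- Input: game, profile. -/
def natMax (d : ℕ) : Code :=
  supLoop (players (var 0)) (comp (natCost d) (var 1 ▹ var 2 ▹ var 0 ▹ const 0))

/-- Input: player, game. -/
def natAlone (d : ℕ) (B : Code) : Code :=
  comp (natCost d) (var 1 ▹ comp (bestMove B) (var 1 ▹ emptyState (var 1) ▹ var 0 ▹ const 0) ▹
    var 0 ▹ const 0)

/-- Input: game. -/
def natMin (d : ℕ) (B : Code) : Code :=
  comp sub (sumLoop (players (var 0)) (natAlone d B) ▹ supLoop (players (var 0))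
    (comp sub (wk (sumLoop (players (var 0)) (natAlone d B)) ▹ natAlone d B)))

/-- The least `j` such that `a ≤ b * 2 ^ j`, for the values `a` and `b` of `f` and `g`. -/
def logRatio (f g : Code) : Code :=
  comp (var 0) (comp (loop (lt (var 2) (var 1))
    (comp add (var 0 ▹ const 1) ▹ var 1 ▹ comp mul (var 2 ▹ const 2) ▹ const 0))
    (const 0 ▹ f ▹ g ▹ const 0))

/-- The ratio of successive boundaries for `n` players and `m` phases. -/
def ratio (d : ℕ) (n m : Code) : Code :=
  comp add (comp mul (comp mul (comp mul (n ▹ const (Game.target d ^ 3)) ▹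
    pow (comp add (const 1 ▹ comp mul (m ▹ const (1 + Game.target d)))) (const d)) ▹
      const (d ^ d)) ▹ const 1)

/-- Input: game, profile. -/
def numSteps (d : ℕ) (B : Code) : Code :=
  logRatio (comp (natMax d) (var 0 ▹ var 1 ▹ const 0)) (comp (natMin d B) (var 0 ▹ const 0))

/-- The game and the parameters of the algorithm. Input: game, profile. -/
def setup (d : ℕ) (B : Code) : Code :=
  var 0 ▹ comp (natMax d) (var 0 ▹ var 1 ▹ const 0) ▹ ratio d (players (var 0)) (numSteps d B) ▹
    max (numSteps d B) (const 1) ▹ numSteps d B ▹ const 0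

end Code

/-! ### Polynomial bounds for the parameters and the programs computing them. -/

namespace Game

section Programs

variable {ι : Type} {N : ι → ℕ} {d : ℕ} {Γ : ι → Game d} {br : ∀ i, (Γ i).ResponseRule}
  {s₀ : ∀ i, (Γ i).Profile}

theorem counts_natMax (hΓ : PolyBdd N fun i => (Γ i).bits) (s : ∀ i, (Γ i).Profile) :
    Counts N (Code.natMax d) (fun i => (Γ i).encode ∷ (Γ i).encodeProfile (s i) ∷ Data.atom 0)
      fun i => (Γ i).natMax (s i) :=
  Counts.sup (polyBdd_n hΓ) (counts_players hΓ (Runs.var 0)).run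
    (Counts.comp ((Runs.var 1).pair ((Runs.var 2).pair ((Runs.var 0).pair (Runs.const 0))))
      (counts_natCost (Γ := fun p : Σ i, Fin (Γ i).n => Γ p.1) (hΓ.reindex Sigma.fst)
        (fun p => s p.1) fun p => p.2))

/-- A family of correct inputs, with polynomially bounded size. -/
structure IsFamily (N : ι → ℕ) (Γ : ι → Game d) (br : ∀ i, (Γ i).ResponseRule)
    (s₀ : ∀ i, (Γ i).Profile) : Prop where
  bits : PolyBdd N fun i => (Γ i).bits
  best : ∀ i, (Γ i).IsBestResponseRule (br i)
  pos : ∀ i, (Γ i).PositiveCosts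
  init : ∀ i, s₀ i ∈ (Γ i).states

theorem IsFamily.reindex {κ : Type} (φ : κ → ι) (h : IsFamily N Γ br s₀) :
    IsFamily (fun k => N (φ k)) (fun k => Γ (φ k)) (fun k => br (φ k)) fun k => s₀ (φ k) :=
  ⟨h.bits.reindex φ, fun _ => h.best _, fun _ => h.pos _, fun _ => h.init _⟩

theorem IsFamily.fewBits_natMax (h : IsFamily N Γ br s₀) :
    FewBits N fun i => (Γ i).natMax (s₀ i) := (counts_natMax h.bits s₀).few

/-- The logarithm is at most the bit length of `natMax`, which is polynomial by `counts_natMax`. -/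
theorem IsFamily.polyBdd_logRatio (h : IsFamily N Γ br s₀) :
    PolyBdd N fun i => (Γ i).logRatio (br i) (s₀ i) :=
  PolyBdd.mono h.fewBits_natMax fun i => logRatio_le_size (h.best i) (h.pos i) _

theorem IsFamily.polyBdd_numPhases (h : IsFamily N Γ br s₀) :
    PolyBdd N fun i => (Γ i).numPhases (br i) (s₀ i) :=
  (h.polyBdd_logRatio.add (PolyBdd.const 1)).mono fun i => by
    unfold numPhases
    omega

/-- The value of g, and not just its bit length, is polynomial, because `d` is constant; `moveBound`
contains g². -/
theorem IsFamily.polyBdd_ratio (h : IsFamily N Γ br s₀) :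
    PolyBdd N fun i => (Γ i).ratio (br i) (s₀ i) :=
  (((((polyBdd_n h.bits).mul (PolyBdd.const _)).mul (((PolyBdd.const 1).add
    (h.polyBdd_logRatio.mul (PolyBdd.const _))).pow d)).mul (PolyBdd.const _)).add
    (PolyBdd.const 1))

theorem IsFamily.polyBdd_moveBound (h : IsFamily N Γ br s₀) :
    PolyBdd N fun i => moveBound (br i) (s₀ i) :=
  (((PolyBdd.const _).mul (polyBdd_n h.bits)).mul (h.polyBdd_ratio.pow 2)).mul (PolyBdd.const _)

theorem counts_natAlone {B : Code} {q : Polynomial ℕ} (h : IsFamily N Γ br s₀)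
    (hB : ∀ i, (Γ i).ComputesWithin B (br i) q) (u : ∀ i, Fin (Γ i).n) :
    Counts N (Code.natAlone d B) (fun i => Data.atom (u i) ∷ (Γ i).encode ∷ Data.atom 0)
      fun i => natAlone (br i) (u i) :=
  Counts.comp ((Runs.var 1).pair ((Runs.comp ((Runs.var 1).pair
    ((runs_emptyState h.bits (Runs.var 1)).pair ((Runs.var 0).pair (Runs.const 0))))
      (runs_bestMove h.bits hB (s := fun i => (Γ i).emptyState) (fun _ => Or.inr rfl) u)).pair
    ((Runs.var 0).pair (Runs.const 0)))) (counts_natCost h.bits _ u)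

theorem counts_natMin {B : Code} {q : Polynomial ℕ} (h : IsFamily N Γ br s₀)
    (hB : ∀ i, (Γ i).ComputesWithin B (br i) q) :
    Counts N (Code.natMin d B) (fun i => (Γ i).encode ∷ Data.atom 0) fun i => natMin (br i) := by
  have hn : Runs N (Code.players (Code.var 0)) (fun i => (Γ i).encode ∷ Data.atom 0) _ :=
    (counts_players h.bits (Runs.var 0)).run
  have ha := counts_natAlone (h.reindex (Sigma.fst : (Σ i, Fin (Γ i).n) → ι)) (fun p => hB p.1)
    fun p => p.2
  have hs := Counts.sum (v := fun i => natAlone (br i)) (polyBdd_n h.bits) hn ha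
  exact hs.sub (Counts.sup (polyBdd_n h.bits) hn ((hs.reindex Sigma.fst).wk.sub ha))

theorem IsFamily.counts_logRatio {f g : Code} {x : ι → Data} (h : IsFamily N Γ br s₀)
    (hf : Counts N f x fun i => (Γ i).natMax (s₀ i)) (hg : Counts N g x fun i => natMin (br i)) :
    Counts N (Code.logRatio f g) x fun i => (Γ i).logRatio (br i) (s₀ i) := by
  have hK := h.polyBdd_logRatio
  -- While the loop runs, the doubled number stays below `natMax` and so has few bits. Its last
  -- value is covered by `hp`.
  have hlt : ∀ i, ∀ j < (Γ i).logRatio (br i) (s₀ i),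
      natMin (br i) * 2 ^ j < (Γ i).natMax (s₀ i) := fun i j hj => by
    rw [← not_le, ← logRatio_le_iff (h.best i) (h.pos i)]
    exact not_le.2 hj
  have hj := FewBits.fin
    (hK.reindex (Sigma.fst : (Σ i, Fin ((Γ i).logRatio (br i) (s₀ i))) → ι)) fun p => p.2
  have hp : FewBits N fun i => natMin (br i) * 2 ^ (Γ i).logRatio (br i) (s₀ i) :=
    hg.few.mul ((FewBits.const 2).pow hK)
  have hm := hf.few.reindex (Sigma.fst : (Σ i, Fin ((Γ i).logRatio (br i) (s₀ i))) → ι)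
  refine ⟨Runs.comp (y := fun i => Data.atom ((Γ i).logRatio (br i) (s₀ i)) ∷
    Data.atom ((Γ i).natMax (s₀ i)) ∷ Data.atom (natMin (br i) * 2 ^ (Γ i).logRatio (br i) (s₀ i)) ∷
      Data.atom 0) ?_ (Runs.var 0), FewBits.of_polyBdd hK⟩
  refine Runs.comp (((Runs.const 0).pair (hf.run.pair ((hg.run.congr fun i => ?_).pair
    (Runs.const 0))))) (Runs.loop (x := fun i j => Data.atom j ∷
      Data.atom ((Γ i).natMax (s₀ i)) ∷ Data.atom (natMin (br i) * 2 ^ j) ∷ Data.atom 0) hK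
      (v := fun i j => Data.atom 1) ?_ ?_ ?_ ?_)
  · simp
  · exact Runs.congr (Decides.lt (Counts.var 2 (hm.mono fun p => (hlt p.1 p.2 p.2.2).le)
      fun _ => rfl) (Counts.var 1 hm fun _ => rfl)) fun p => Data.bool_of (hlt p.1 p.2 p.2.2)
  · simp
  · refine (((Counts.var 0 hj fun _ => rfl).add (Counts.const 1)).run.pair
      ((Runs.var 1).pair (((Counts.var 2 (hm.mono fun p => (hlt p.1 p.2 p.2.2).le)
        fun _ => rfl).mul (Counts.const 2)).run.pair (Runs.const 0)))).congr fun p => ?_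
    rw [pow_succ, ← mul_assoc]
    rfl
  · exact Runs.congr (Decides.lt (Counts.var 2 hp fun _ => rfl)
      (Counts.var 1 hf.few fun _ => rfl)) fun i => Data.bool_of_not
        (not_lt.2 ((logRatio_le_iff (h.best i) (h.pos i) _ _).1 le_rfl))

/-- The game and the parameters of the algorithm. -/
def setup {d : ℕ} (Γ : Game d) (br : Γ.ResponseRule) (s₀ : Γ.Profile) : Data :=
  Γ.encode ∷ Data.atom (Γ.natMax s₀) ∷ Data.atom (Γ.ratio br s₀) ∷
    Data.atom (Γ.numPhases br s₀) ∷ Data.atom (Γ.logRatio br s₀) ∷ Data.atom 0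

theorem runs_setup {B : Code} {q : Polynomial ℕ} (h : IsFamily N Γ br s₀)
    (hB : ∀ i, (Γ i).ComputesWithin B (br i) q) (z : ι → Data) :
    Runs N (Code.setup d B) (fun i => (Γ i).encode ∷ (Γ i).encodeProfile (s₀ i) ∷ z i)
      fun i => (Γ i).setup (br i) (s₀ i) := by
  have hmax : Counts N (Code.comp (Code.natMax d) (Code.var 0 ▹ Code.var 1 ▹ Code.const 0))
      (fun i => (Γ i).encode ∷ (Γ i).encodeProfile (s₀ i) ∷ z i) _ :=
    Counts.comp ((Runs.var 0).pair ((Runs.var 1).pair (Runs.const 0))) (counts_natMax h.bits s₀)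
  have hm : Counts N (Code.numSteps d B)
      (fun i => (Γ i).encode ∷ (Γ i).encodeProfile (s₀ i) ∷ z i) _ := h.counts_logRatio hmax
    (Counts.comp ((Runs.var 0).pair (Runs.const 0)) (counts_natMin h hB))
  exact (Runs.var 0).pair (hmax.run.pair ((((((counts_players h.bits (Runs.var 0)).mul
    (Counts.const _)).mul (((Counts.const 1).add (hm.mul (Counts.const _))).pow (Counts.const d)
      (PolyBdd.const d))).mul (Counts.const _)).add (Counts.const 1)).run.pair
    ((hm.max (Counts.const 1)).run.pair (hm.run.pair (Runs.const 0)))))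

end Programs

end Game

/-! ## Search -/

open Classical in
/-- The least number less than `j` that satisfies `p`. -/
noncomputable def firstHit {n : ℕ} (p : Fin n → Prop) : ℕ → Option (Fin n)
  | 0 => none
  | j + 1 => (firstHit p j).or (if h : ∃ hj : j < n, p ⟨j, hj⟩ then some ⟨j, h.1⟩ else none)

theorem of_firstHit_eq_some {n : ℕ} {p : Fin n → Prop} {j : ℕ} {u : Fin n}
    (h : firstHit p j = some u) : p u := by
  induction j with
  | zero => simp [firstHit] at h
  | succ j ih =>
    rw [firstHit, Option.or_eq_some_iff] at h
    rcases h with h | ⟨-, h⟩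
    · exact ih h
    · split_ifs at h with hp
      obtain rfl := Option.some.inj h
      exact hp.2

theorem of_firstHit_eq_none {n : ℕ} {p : Fin n → Prop} {j : ℕ}
    (h : firstHit p j = none) (u : Fin n) (hu : (u : ℕ) < j) : ¬ p u := by
  induction j with
  | zero => omega
  | succ j ih =>
    rw [firstHit, Option.or_eq_none_iff] at h
    rcases Nat.lt_succ_iff_lt_or_eq.1 hu with hu | rfl
    · exact ih h.1 hu
    · intro hp
      simp [hp] at h

/-- `0` for `none`, and `u + 1` for `some u`. -/
def Option.toIndex {n : ℕ} (o : Option (Fin n)) : ℕ := o.elim 0 fun u => u + 1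

theorem Option.toIndex_le {n : ℕ} (o : Option (Fin n)) : o.toIndex ≤ n := by
  cases o with
  | none => exact Nat.zero_le _
  | some u => exact u.2

theorem Counts.search {ι : Type} {N K : ι → ℕ} {x : ι → Data} {nc f : Code} (hK : PolyBdd N K)
    (hn : Runs N nc x (fun i => Data.atom (K i))) {p : ∀ i, Fin (K i) → Prop}
    (hf : Decides (fun q : Σ i, Fin (K i) => N q.1) f (fun q => Data.atom q.2 ∷ x q.1)
      (fun q => p q.1 q.2)) :
    Counts N (Code.search nc f) x (fun i => (firstHit (p i) (K i)).toIndex) := by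
  refine Counts.forLoop (w := fun i j => (firstHit (p i) j).toIndex) hK hn (Runs.const 0)
    (FewBits.of_polyBdd (hK.mono fun i => Option.toIndex_le _)) ?_
  have hj : FewBits (fun q : Σ i, Fin (K i) => N q.1) (fun q => (q.2 : ℕ)) :=
    FewBits.fin (K := fun q : Σ i, Fin (K i) => K q.1) (hK.reindex Sigma.fst) fun q => q.2
  have hf' : Decides (fun q : Σ i, Fin (K i) => N q.1)
      (Code.comp f (Code.var 0 ▹ Code.comp Code.right Code.right))
      (fun q => Data.atom q.2 ∷ Data.atom (firstHit (p q.1) q.2).toIndex ∷ x q.1)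
      (fun q => p q.1 q.2) :=
    Decides.comp ((Runs.var 0).pair (Runs.comp Runs.right Runs.right)) hf
  refine Runs.cond (Runs.var 1) ((Runs.var 1).congr fun q => ?_) (Runs.ite
    (hf'.reindex Subtype.val) (Runs.congr (Counts.add (Counts.var 0
        ((hj.reindex Subtype.val).reindex Subtype.val) fun _ => rfl)
          (Counts.const 1)).run fun q => ?_) ((Runs.const 0).congr fun q => ?_))
  · obtain ⟨⟨i, j⟩, h⟩ := q
    have h' : Data.atom (firstHit (p i) j).toIndex ≠ Data.atom 0 := h
    change Data.atom _ = Data.atom _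
    rw [firstHit]
    cases h2 : firstHit (p i) j with
    | none => simp [h2, Option.toIndex] at h'
    | some u => simp
  · obtain ⟨⟨⟨i, j⟩, h⟩, hp⟩ := q
    have h' : Data.atom (firstHit (p i) j).toIndex = Data.atom 0 := h
    change Data.atom _ = Data.atom _
    have hp' : p i j := hp
    rw [firstHit]
    cases h2 : firstHit (p i) j with
    | none => simp [hp', Option.toIndex]
    | some u => simp [h2, Option.toIndex] at h'
  · obtain ⟨⟨⟨i, j⟩, h⟩, hp⟩ := q
    have h' : Data.atom (firstHit (p i) j).toIndex = Data.atom 0 := h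
    change Data.atom _ = Data.atom _
    have hp' : ¬ p i j := hp
    rw [firstHit]
    cases h2 : firstHit (p i) j with
    | none => simp [hp', Option.toIndex]
    | some u => simp [h2, Option.toIndex] at h'

/-! ## Programs for the steps of the algorithm -/

namespace Code

/-- Input: player, configuration, setup. -/
def phase : Code := comp left (var 1)

/-- Input: player, configuration, setup. -/
def isFixed : Code := nth (comp left (comp right (var 1))) (var 0)

/-- Input: player, configuration, setup. -/
def currentCost (d : ℕ) : Code :=
  comp (natCost d) (var 2 ▹ comp right (comp right (var 1)) ▹ var 0 ▹ const 0)

/-- Input: player, configuration, setup. -/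
def bestCost (d : ℕ) (B : Code) : Code :=
  comp (natCost d) (var 2 ▹ comp (bestMove B)
    (var 2 ▹ comp right (comp right (var 1)) ▹ var 0 ▹ const 0) ▹ var 0 ▹ const 0)

/-- Does the player's cost reach the boundary with index `i`?
Input: player, configuration, setup. -/
def isCostly (d : ℕ) (i : Code) : Code :=
  (lt (comp mul (currentCost d ▹ pow (var 4) i)) (var 3)).not

/-- Input: player, configuration, setup. -/
def hasLowMove (d : ℕ) (B : Code) : Code :=
  lt (comp mul (const (Game.decreaseDen d) ▹ bestCost d B))
    (comp mul (const (Game.target d) ▹ currentCost d))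

/-- Input: player, configuration, setup. -/
def hasTargetMove (d : ℕ) (B : Code) : Code :=
  lt (comp mul (const (Game.target d) ▹ bestCost d B)) (currentCost d)

/-- Input: player, configuration, setup. -/
def eligible (d : ℕ) (B : Code) : Code :=
  ((eq phase (const 0)).and ((isCostly d (const 1)).and (hasLowMove d B))).or
    ((lt phase (const 1)).not.and ((lt phase (var 5)).and (isFixed.not.and
      (((isCostly d (comp add (phase ▹ const 1))).and
        ((isCostly d phase).not.and (hasLowMove d B))).or
      ((isCostly d phase).and (hasTargetMove d B))))))

/-- Is the player fixed after the end of the phase? Input: player, configuration, setup. -/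
def becomesFixed (d : ℕ) : Code :=
  (isFixed.or ((eq phase (const 0)).not.and (isCostly d phase))).or
    ((lt (comp add (phase ▹ const 1)) (var 5)).not.and (isCostly d (var 6)))

/-- Input: index of a player plus one, or zero for the end of the phase; configuration, setup. -/
def next (d : ℕ) (B : Code) : Code :=
  cond (var 0)
    (comp left (var 1) ▹ comp left (comp right (var 1)) ▹
      comp (bestMove B) (var 2 ▹ comp right (comp right (var 1)) ▹
        comp sub (var 0 ▹ const 1) ▹ const 0))
    (comp add (comp left (var 1) ▹ const 1) ▹
      table (players (var 2)) (comp (becomesFixed d) (var 0 ▹ comp right right)) ▹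
        comp right (comp right (var 1)))

/-- The index plus one of the player to move, or zero. Input: configuration, preferences,
output, setup. -/
def choice (d : ℕ) (B : Code) : Code :=
  cond (var 1)
    (cond (comp (eligible d B) (comp left (var 1) ▹ var 0 ▹ comp right (comp right right)))
      (comp add (comp left (var 1) ▹ const 1))
      (search (players (var 3)) (comp (eligible d B)
        (var 0 ▹ var 1 ▹ comp right (comp right (comp right right))))))
    (search (players (var 3)) (comp (eligible d B)
      (var 0 ▹ var 1 ▹ comp right (comp right (comp right right)))))

/-- The algorithm with best-response routine `B`. -/
def algorithm (d : ℕ) (B : Code) : Code :=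
  comp (reverse (var 0 ▹ var 2)) (comp
    (loop (lt (comp left (var 0)) (var 6))
      (comp (next d B) (choice d B ▹ var 0 ▹ comp right (comp right right)) ▹
        comp right (var 1) ▹ (var 0 ▹ var 2) ▹ comp right (comp right right)))
    ((const 0 ▹ table (players (var 0)) (const 0) ▹ var 1) ▹ comp right right ▹ const 0 ▹ setup d B))

end Code

/-! ### Correctness and running time of a single step of the algorithm. -/

namespace Game

section Programs

variable {ι : Type} {N : ι → ℕ} {d : ℕ} {Γ : ι → Game d} {br : ∀ i, (Γ i).ResponseRule}
  {s₀ : ∀ i, (Γ i).Profile}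

section Player

variable {c : ∀ i, (Γ i).Config} {u : ∀ i, Fin (Γ i).n} {z : ι → Data}

theorem counts_currentCost (hΓ : PolyBdd N fun i => (Γ i).bits) (c : ∀ i, (Γ i).Config)
    (u : ∀ i, Fin (Γ i).n) :
    Counts N (Code.currentCost d)
      (fun i => Data.atom (u i) ∷ (c i).encode ∷ (Γ i).setup (br i) (s₀ i))
      fun i => (Γ i).natCost (u i) (c i).state :=
  Counts.comp ((Runs.var 2).pair ((Runs.comp (Runs.comp (Runs.var 1) Runs.right) Runs.right).pair
    ((Runs.var 0).pair (Runs.const 0)))) (counts_natCost hΓ _ u)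

theorem counts_phase (h : IsFamily N Γ br s₀)
    (hc : ∀ i, (c i).phase ≤ (Γ i).numPhases (br i) (s₀ i)) :
    Counts N Code.phase (fun i => Data.atom (u i) ∷ (c i).encode ∷ z i)
      fun i => (c i).phase :=
  ⟨Runs.comp (Runs.var 1) Runs.left, FewBits.of_polyBdd (h.polyBdd_numPhases.mono hc)⟩

theorem decides_isFixed (hΓ : PolyBdd N fun i => (Γ i).bits) :
    Decides N Code.isFixed (fun i => Data.atom (u i) ∷ (c i).encode ∷ z i)
      fun i => u i ∈ (c i).fixed :=
  decides_mem (polyBdd_n hΓ) (Runs.comp (Runs.comp (Runs.var 1) Runs.right) Runs.left) (Runs.var 0)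

theorem decides_isCostly (h : IsFamily N Γ br s₀) {ic : Code} {e : ι → ℕ}
    (he : PolyBdd N e) (hi : Counts N ic
      (fun i => Data.atom (u i) ∷ (c i).encode ∷ (Γ i).setup (br i) (s₀ i)) e) :
    Decides N (Code.isCostly d ic)
      (fun i => Data.atom (u i) ∷ (c i).encode ∷ (Γ i).setup (br i) (s₀ i))
      fun i => (Γ i).natMax (s₀ i) ≤
        (Γ i).natCost (u i) (c i).state * (Γ i).ratio (br i) (s₀ i) ^ e i :=
  Decides.le (Counts.var 3 h.fewBits_natMax fun _ => rfl)
    ((counts_currentCost h.bits c u).mul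
      ((Counts.var 4 (FewBits.of_polyBdd h.polyBdd_ratio) fun _ => rfl).pow hi he))

theorem counts_bestCost {B : Code} {q : Polynomial ℕ} (h : IsFamily N Γ br s₀)
    (hB : ∀ i, (Γ i).ComputesWithin B (br i) q) (hs : ∀ i, (c i).state ∈ (Γ i).states) :
    Counts N (Code.bestCost d B)
      (fun i => Data.atom (u i) ∷ (c i).encode ∷ (Γ i).setup (br i) (s₀ i))
      fun i => (Γ i).natCost (u i) (respondTo (br i) (c i).state (u i)) :=
  Counts.comp ((Runs.var 2).pair ((Runs.comp ((Runs.var 2).pair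
    ((Runs.comp (Runs.comp (Runs.var 1) Runs.right) Runs.right).pair
      ((Runs.var 0).pair (Runs.const 0))))
      (runs_bestMove h.bits hB (fun i => Or.inl (hs i)) u)).pair
    ((Runs.var 0).pair (Runs.const 0)))) (counts_natCost h.bits _ u)

theorem decides_eligible {B : Code} {q : Polynomial ℕ} (hd : 1 ≤ d) (h : IsFamily N Γ br s₀)
    (hB : ∀ i, (Γ i).ComputesWithin B (br i) q) (hs : ∀ i, (c i).state ∈ (Γ i).states)
    (hc : ∀ i, (c i).phase ≤ (Γ i).numPhases (br i) (s₀ i)) :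
    Decides N (Code.eligible d B)
      (fun i => Data.atom (u i) ∷ (c i).encode ∷ (Γ i).setup (br i) (s₀ i))
      fun i => Eligible (br i) (s₀ i) (c i) (u i) := by
  refine Decides.congr ?_ fun i => (eligible_iff hd (h.best i) (hs i) (u i)).symm
  have hphase : Counts N Code.phase
      (fun i => Data.atom (u i) ∷ (c i).encode ∷ (Γ i).setup (br i) (s₀ i)) _ := counts_phase h hc
  have hp : PolyBdd N fun i => (c i).phase := h.polyBdd_numPhases.mono hc
  have hcur := counts_currentCost (br := br) (s₀ := s₀) h.bits c u
  have hbest := counts_bestCost (u := u) h hB hs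
  have hlow := Decides.lt ((Counts.const (decreaseDen d)).mul hbest)
    ((Counts.const (target d)).mul hcur)
  have hhigh := Decides.lt ((Counts.const (target d)).mul hbest) hcur
  have hcp := decides_isCostly h hp hphase
  exact ((Decides.eq hphase (Counts.const 0)).and
      ((decides_isCostly h (PolyBdd.const 1) (Counts.const 1)).and hlow)).or
    ((Decides.le (Counts.const 1) hphase).and ((Decides.lt hphase
      (Counts.var 5 (FewBits.of_polyBdd h.polyBdd_numPhases) fun _ => rfl)).and
      ((decides_isFixed h.bits).not.and
      (((decides_isCostly h (hp.add (PolyBdd.const 1)) (hphase.add (Counts.const 1))).and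
        (hcp.not.and hlow)).or (hcp.and hhigh)))))

theorem decides_becomesFixed (h : IsFamily N Γ br s₀)
    (hc : ∀ i, (c i).phase ≤ (Γ i).numPhases (br i) (s₀ i)) :
    Decides N (Code.becomesFixed d)
      (fun i => Data.atom (u i) ∷ (c i).encode ∷ (Γ i).setup (br i) (s₀ i))
      fun i => u i ∈ ((c i).close (br i) (s₀ i)).fixed := by
  have hphase : Counts N Code.phase
      (fun i => Data.atom (u i) ∷ (c i).encode ∷ (Γ i).setup (br i) (s₀ i)) _ := counts_phase h hc
  have hp : PolyBdd N fun i => (c i).phase := h.polyBdd_numPhases.mono hc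
  have hcp := decides_isCostly h hp hphase
  refine (((decides_isFixed h.bits).or ((Decides.eq hphase (Counts.const 0)).not.and hcp)).or
    ((Decides.lt (hphase.add (Counts.const 1))
      (Counts.var 5 (FewBits.of_polyBdd h.polyBdd_numPhases) fun _ => rfl)).not.and
      (decides_isCostly h h.polyBdd_logRatio
        (Counts.var 6 (FewBits.of_polyBdd h.polyBdd_logRatio) fun _ => rfl)))).congr fun i => ?_
  have e : ∀ (P : Prop) [Decidable P] (S : Finset (Fin (Γ i).n)),
      u i ∈ (if P then ∅ else S) ↔ ¬ P ∧ u i ∈ S := fun P _ S => by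
    by_cases hP : P <;> simp [hP]
  simp only [Config.close, Finset.mem_union, costly, e, Finset.mem_filter, Finset.mem_univ,
    true_and, boundary_le_cost_iff]

end Player

/-- The next configuration, given the choice of the player to move. -/
def Config.next {d : ℕ} {Γ : Game d} (br : Γ.ResponseRule) (s₀ : Γ.Profile) (c : Γ.Config) :
    Option (Fin Γ.n) → Γ.Config
  | none => c.close br s₀
  | some u => c.move br u

open Classical in
/-- The player to move: the first one in the list if she is eligible, and otherwise the first
eligible player, if any. -/
noncomputable def choose {d : ℕ} {Γ : Game d} (br : Γ.ResponseRule) (s₀ : Γ.Profile)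
    (c : Γ.Config) : List (Fin Γ.n) → Option (Fin Γ.n)
  | [] => firstHit (Eligible br s₀ c) Γ.n
  | u :: _ => if Eligible br s₀ c u then some u else firstHit (Eligible br s₀ c) Γ.n

variable {c : ∀ i, (Γ i).Config}

theorem runs_next {B : Code} {q : Polynomial ℕ} (h : IsFamily N Γ br s₀)
    (hB : ∀ i, (Γ i).ComputesWithin B (br i) q) (hs : ∀ i, (c i).state ∈ (Γ i).states)
    (hc : ∀ i, (c i).phase ≤ (Γ i).numPhases (br i) (s₀ i)) (o : ∀ i, Option (Fin (Γ i).n)) :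
    Runs N (Code.next d B)
      (fun i => Data.atom (o i).toIndex ∷ (c i).encode ∷ (Γ i).setup (br i) (s₀ i))
      fun i => ((c i).next (br i) (s₀ i) (o i)).encode := by
  have hphase : Counts N (Code.comp Code.left (Code.var 1))
      (fun i => Data.atom (o i).toIndex ∷ (c i).encode ∷ (Γ i).setup (br i) (s₀ i))
      fun i => (c i).phase :=
    ⟨Runs.comp (Runs.var 1) Runs.left, FewBits.of_polyBdd (h.polyBdd_numPhases.mono hc)⟩
  refine Runs.cond (Runs.var 0) ?_ ?_
  · have ho : ∀ i : {i // Data.atom (o i).toIndex ≠ Data.atom 0}, ∃ u, o i = some u := by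
      rintro ⟨i, hi⟩
      cases e : o i with
      | none => simp [e, Option.toIndex] at hi
      | some u => exact ⟨u, rfl⟩
    choose u hu using ho
    have h' := h.reindex (Subtype.val : {i // Data.atom (o i).toIndex ≠ Data.atom 0} → ι)
    refine ((Runs.comp (Runs.var 1) Runs.left).pair ((Runs.comp (Runs.comp (Runs.var 1)
      Runs.right) Runs.left).pair (Runs.comp ((Runs.var 2).pair ((Runs.comp (Runs.comp
        (Runs.var 1) Runs.right) Runs.right).pair ((Runs.congr (Counts.sub (Counts.var 0
          (a := fun i : {i // Data.atom (o i).toIndex ≠ Data.atom 0} => (o i).toIndex)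
          ?_ fun _ => rfl) (Counts.const 1)).run fun i => ?_).pair (Runs.const 0))))
      (runs_bestMove h'.bits (fun i => hB i) (fun i => Or.inl (hs i)) u)))).congr fun i => ?_
    · exact FewBits.of_polyBdd ((polyBdd_n h'.bits).mono fun i => Option.toIndex_le _)
    · rw [hu i]
      rfl
    · rw [hu i]
      rfl
  · have h' := h.reindex (Subtype.val : {i // Data.atom (o i).toIndex = Data.atom 0} → ι)
    have h'' := h'.reindex (Sigma.fst :
      (Σ i : {i // Data.atom (o i).toIndex = Data.atom 0}, Fin (Γ i).n) → _)
    refine (((hphase.reindex Subtype.val).add (Counts.const 1)).run.pair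
      ((Runs.table (y := fun i : {i // Data.atom (o i).toIndex = Data.atom 0} => fun u =>
        Data.bool (u ∈ ((c i).close (br i) (s₀ i)).fixed))
        (polyBdd_n h'.bits) (counts_players h'.bits (Runs.var 2)).run (Decides.comp ((Runs.var 0).pair (Runs.comp Runs.right Runs.right))
          (decides_becomesFixed (c := fun p : Σ i : {i // Data.atom (o i).toIndex = Data.atom 0},
            Fin (Γ i).n => c p.1) (u := fun p => p.2) h'' fun p => hc _))).pair
        (Runs.comp (Runs.comp (Runs.var 1) Runs.right) Runs.right))).congr fun i => ?_
    have e : o i = none := by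
      obtain ⟨i, hi⟩ := i
      cases e : o i with
      | none => rfl
      | some u => simp [e, Option.toIndex] at hi
    rw [e]
    change _ = Data.atom _ ∷ Data.ofFinset ((c i).close (br i) (s₀ i)).fixed ∷ _
    rw [Data.ofFinset_eq]
    rfl

theorem runs_choice {B : Code} {q : Polynomial ℕ} (hd : 1 ≤ d) (h : IsFamily N Γ br s₀)
    (hB : ∀ i, (Γ i).ComputesWithin B (br i) q) (hs : ∀ i, (c i).state ∈ (Γ i).states)
    (hc : ∀ i, (c i).phase ≤ (Γ i).numPhases (br i) (s₀ i))
    (prefs : ∀ i, List (Fin (Γ i).n)) (z : ι → Data) :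
    Runs N (Code.choice d B) (fun i => (c i).encode ∷
      Data.ofList (fun u : Fin (Γ i).n => Data.atom (u : ℕ)) (prefs i) ∷ z i ∷
        (Γ i).setup (br i) (s₀ i))
      fun i => Data.atom (choose (br i) (s₀ i) (c i) (prefs i)).toIndex := by
  have hsearch : Runs N (Code.search (Code.players (Code.var 3)) (Code.comp (Code.eligible d B)
      (Code.var 0 ▹ Code.var 1 ▹
        Code.comp Code.right (Code.comp Code.right (Code.comp Code.right Code.right)))))
      (fun i => (c i).encode ∷
        Data.ofList (fun u : Fin (Γ i).n => Data.atom (u : ℕ)) (prefs i) ∷ z i ∷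
          (Γ i).setup (br i) (s₀ i))
      fun i => Data.atom (firstHit (Eligible (br i) (s₀ i) (c i)) (Γ i).n).toIndex := by
    refine (Counts.search (polyBdd_n h.bits) (counts_players h.bits (Runs.var 3)).run ?_).run
    exact Decides.comp ((Runs.var 0).pair ((Runs.var 1).pair (Runs.comp (Runs.comp
      (Runs.comp Runs.right Runs.right) Runs.right) Runs.right)))
      (decides_eligible (c := fun p : Σ i, Fin (Γ i).n => c p.1) (u := fun p => p.2) hd (h.reindex Sigma.fst)
        (fun p => hB p.1) (fun p => hs p.1) fun p => hc p.1)
  refine Runs.cond (Runs.var 1) ?_ ?_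
  · have hu : ∀ i : {i // Data.ofList (fun u : Fin (Γ i).n => Data.atom (u : ℕ)) (prefs i) ≠
        Data.atom 0}, ∃ u l, prefs i = u :: l := by
      rintro ⟨i, hi⟩
      cases e : prefs i with
      | nil => simp [e, Data.ofList] at hi
      | cons u l => exact ⟨u, l, rfl⟩
    choose u l hu using hu
    have h' := h.reindex (Subtype.val : {i // Data.ofList (fun u : Fin (Γ i).n =>
      Data.atom (u : ℕ)) (prefs i) ≠ Data.atom 0} → ι)
    have hl : Counts (fun i : {i // Data.ofList (fun u : Fin (Γ i).n => Data.atom (u : ℕ))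
        (prefs i) ≠ Data.atom 0} => N i) (Code.comp Code.left (Code.var 1)) (fun i => (c i).encode ∷
        Data.ofList (fun u : Fin (Γ i).n => Data.atom (u : ℕ)) (prefs i) ∷ z i ∷
          (Γ i).setup (br i) (s₀ i)) fun i => (u i : ℕ) :=
      ⟨(Runs.comp (Runs.var 1) Runs.left).congr fun i => by
        simp [Data.dropEntries, Data.left, Data.right, hu i, Data.ofList],
        FewBits.fin (polyBdd_n h'.bits) u⟩
    refine Runs.ite (Decides.comp (hl.run.pair ((Runs.var 0).pair (Runs.comp (Runs.comp
      Runs.right Runs.right) Runs.right))) (decides_eligible (c := fun i : {i // Data.ofList (fun u : Fin (Γ i).n =>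
      Data.atom (u : ℕ)) (prefs i) ≠ Data.atom 0} => c i.1) (u := u) hd h'
        (fun p => hB p.1) (fun p => hs p.1) fun p => hc p.1)) ?_ ?_
    · refine ((hl.reindex Subtype.val).add (Counts.const 1)).run.congr fun i => ?_
      rw [hu i.1, choose, if_pos i.2]
      rfl
    · refine ((hsearch.reindex Subtype.val).reindex Subtype.val).congr fun i => ?_
      rw [hu i.1, choose, if_neg i.2]
  · refine (hsearch.reindex Subtype.val).congr fun i => ?_
    have e : prefs i = [] := by
      obtain ⟨i, hi⟩ := i
      have hi' : Data.ofList (fun u : Fin (Γ i).n => Data.atom (u : ℕ)) (prefs i) = Data.atom 0 := hi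
      cases e : prefs i with
      | nil => rfl
      | cons u l => simp [e, Data.ofList] at hi'
    rw [e, choose]

end Programs

end Game

/-! ## The execution carried out by the program -/

namespace Game

section Trace

variable {d : ℕ} {Γ : Game d}

/-- The configurations of the execution that follows `prefs`. -/
noncomputable def trace (br : Γ.ResponseRule) (s₀ : Γ.Profile) (prefs : List (Fin Γ.n)) :
    ℕ → Γ.Config
  | 0 => ⟨0, ∅, s₀⟩
  | j + 1 => (trace br s₀ prefs j).next br s₀
      (choose br s₀ (trace br s₀ prefs j) (prefs.drop j))

variable {br : Γ.ResponseRule} {s₀ : Γ.Profile} {prefs : List (Fin Γ.n)}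

theorem step_next {c : Γ.Config} (hc : c.phase < Γ.numPhases br s₀) (l : List (Fin Γ.n)) :
    Step br s₀ c (c.next br s₀ (choose br s₀ c l)) := by
  have key : Step br s₀ c (c.next br s₀ (firstHit (Eligible br s₀ c) Γ.n)) := by
    cases h : firstHit (Eligible br s₀ c) Γ.n with
    | none => exact Step.close c hc fun u => of_firstHit_eq_none h u u.2
    | some u => exact Step.move c u (of_firstHit_eq_some h)
  cases l with
  | nil => exact key
  | cons u l =>
    rw [choose]
    split_ifs with h
    · exact Step.move c u h
    · exact key

theorem trace_mem (hbr : Γ.IsBestResponseRule br) (hs : s₀ ∈ Γ.states) (j : ℕ) :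
    (trace br s₀ prefs j).state ∈ Γ.states := by
  induction j with
  | zero => exact hs
  | succ j ih =>
    rw [trace]
    cases choose br s₀ (trace br s₀ prefs j) (prefs.drop j) with
    | none => exact ih
    | some u => exact respondTo_mem hbr ih u

/-- The hypothesis is needed because `trace` goes on closing phases after the last one, and these
are not steps of the algorithm. -/
theorem isPartialRun_trace {j : ℕ}
    (h : ∀ i < j, (trace br s₀ prefs i).phase < Γ.numPhases br s₀) :
    IsPartialRun br s₀ ((List.range (j + 1)).map (trace br s₀ prefs)) := by
  refine ⟨by simp [List.range_succ_eq_map, trace], ?_⟩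
  rw [List.isChain_map, List.isChain_range_succ]
  exact fun i hi => step_next (h i hi) _

theorem Step.phase_le {c c' : Γ.Config} (h : Step br s₀ c c') :
    c'.phase ≤ Γ.numPhases br s₀ := by
  cases h with
  | move u hu => exact hu.phase_lt.le
  | close hc _ => exact hc

-- The length bound for partial runs also proves termination: an execution that never finished would
-- contain partial runs of every length.
variable (prefs) in
theorem exists_trace_phase_eq (hd : 1 ≤ d) (hbr : Γ.IsBestResponseRule br)
    (hpos : Γ.PositiveCosts) (hs : s₀ ∈ Γ.states) :
    ∃ K ≤ Γ.numPhases br s₀ * (moveBound br s₀ + 1),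
      (trace br s₀ prefs K).phase = Γ.numPhases br s₀ ∧
        ∀ j < K, (trace br s₀ prefs j).phase < Γ.numPhases br s₀ := by
  classical
  set T := Γ.numPhases br s₀ * (moveBound br s₀ + 1) with hT
  -- Otherwise the first `T + 2` configurations would form a partial run, while `T + 1` is the
  -- maximal length.
  have h1 : ∃ j ≤ T, ¬ (trace br s₀ prefs j).phase < Γ.numPhases br s₀ := by
    by_contra! h
    have := length_le_of_isPartialRun hd hbr hpos hs
      (isPartialRun_trace (prefs := prefs) (j := T + 1) fun i hi => h i (Nat.lt_succ_iff.1 hi))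
    rw [List.length_map, List.length_range] at this
    omega
  have h2 : ∃ j, ¬ (trace br s₀ prefs j).phase < Γ.numPhases br s₀ := ⟨_, h1.choose_spec.2⟩
  have h3 : ∀ j < Nat.find h2, (trace br s₀ prefs j).phase < Γ.numPhases br s₀ := fun j hj =>
    not_not.1 (Nat.find_min h2 hj)
  refine ⟨Nat.find h2, (Nat.find_le h1.choose_spec.2).trans h1.choose_spec.1, ?_, h3⟩
  refine le_antisymm ?_ (not_lt.1 (Nat.find_spec h2))
  cases e : Nat.find h2 with
  | zero => exact Nat.zero_le _
  | succ j => exact (step_next (h3 j (by omega)) _).phase_le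

theorem follows_trace (K : ℕ) :
    Follows br s₀ prefs ((List.range (K + 1)).map (trace br s₀ prefs)) := by
  intro t c c' u h1 h2 hu he
  rw [List.getElem?_map, Option.map_eq_some_iff] at h1 h2
  obtain ⟨a, ha, rfl⟩ := h1
  obtain ⟨b, hb, rfl⟩ := h2
  rw [List.getElem?_eq_some_iff] at ha hb hu
  obtain ⟨_, rfl⟩ := ha
  obtain ⟨_, rfl⟩ := hb
  obtain ⟨ht, rfl⟩ := hu
  rw [List.getElem_range] at he ⊢
  rw [List.getElem_range, trace, List.drop_eq_getElem_cons ht, choose, if_pos he]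
  rfl

end Trace

theorem algInput_eq {d : ℕ} {Γ : Game d} (s₀ : Γ.Profile) (prefs : List (Fin Γ.n)) :
    algInput s₀ prefs = Γ.encode ∷ Γ.encodeProfile s₀ ∷
      Data.ofList (fun u : Fin Γ.n => Data.atom (u : ℕ)) prefs := by
  unfold algInput
  congr 2
  induction prefs with
  | nil => rfl
  | cons u l ih => exact congrArg (Data.pair (Data.atom u)) ih

section Programs

variable {ι : Type} {N : ι → ℕ} {d : ℕ} {Γ : ι → Game d} {br : ∀ i, (Γ i).ResponseRule}
  {s₀ : ∀ i, (Γ i).Profile}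

/-- The loop state consists of the configuration, the unread preferences, the earlier configurations
in reverse order and the parameters. Only `K` and the numbers involved need polynomial bounds; the
length of `prefs` does not matter, since a step merely takes the tail of the list. -/
theorem runs_algorithm {B : Code} {q : Polynomial ℕ} (hd : 1 ≤ d) (h : IsFamily N Γ br s₀)
    (hB : ∀ i, (Γ i).ComputesWithin B (br i) q) (prefs : ∀ i, List (Fin (Γ i).n))
    {K : ι → ℕ} (hK : PolyBdd N K)
    (hlt : ∀ i, ∀ j < K i, (trace (br i) (s₀ i) (prefs i) j).phase < (Γ i).numPhases (br i) (s₀ i))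
    (heq : ∀ i, (trace (br i) (s₀ i) (prefs i) (K i)).phase = (Γ i).numPhases (br i) (s₀ i)) :
    Runs N (Code.algorithm d B) (fun i => algInput (s₀ i) (prefs i))
      fun i => Data.ofList Config.encode
        ((List.range (K i + 1)).map (trace (br i) (s₀ i) (prefs i))) := by
  simp only [algInput_eq]
  let c : ∀ i, ℕ → (Γ i).Config := fun i j => trace (br i) (s₀ i) (prefs i) j
  let out : ∀ i, ℕ → Data := fun i j => Data.ofList Config.encode ((List.range j).map (c i)).reverse
  let rest : ∀ i, ℕ → Data := fun i j =>
    Data.ofList (fun u : Fin (Γ i).n => Data.atom (u : ℕ)) ((prefs i).drop j)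
  let x : ι → ℕ → Data := fun i j =>
    (c i j).encode ∷ rest i j ∷ out i j ∷ (Γ i).setup (br i) (s₀ i)
  have hM := FewBits.of_polyBdd h.polyBdd_numPhases
  have h' := h.reindex (Sigma.fst : (Σ i, Fin (K i)) → ι)
  have hinit : Runs N ((Code.const 0 ▹ Code.table (Code.players (Code.var 0)) (Code.const 0) ▹ Code.var 1) ▹
      Code.comp Code.right Code.right ▹ Code.const 0 ▹ Code.setup d B)
      (fun i => (Γ i).encode ∷ (Γ i).encodeProfile (s₀ i) ∷
        Data.ofList (fun u : Fin (Γ i).n => Data.atom (u : ℕ)) (prefs i)) fun i => x i 0 := by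
    refine Runs.congr (((Runs.const 0).pair ((Runs.table (y := fun _ _ => Data.atom 0)
      (polyBdd_n h.bits) (counts_players h.bits (Runs.var 0)).run (Runs.const 0)).pair
        (Runs.var 1))).pair ((Runs.comp Runs.right Runs.right).pair
          ((Runs.const 0).pair (runs_setup h hB _)))) fun i => ?_
    have e1 : rest i 0 = Data.ofList (fun u : Fin (Γ i).n => Data.atom (u : ℕ)) (prefs i) :=
      congrArg _ List.drop_zero
    have e2 : out i 0 = Data.atom 0 := by simp [out, Data.ofList]
    have e3 : (c i 0).encode = Data.atom 0 ∷ Data.ofFinset (∅ : Finset (Fin (Γ i).n)) ∷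
      (Γ i).encodeProfile (s₀ i) := rfl
    change _ = (c i 0).encode ∷ rest i 0 ∷ out i 0 ∷ _
    rw [e1, e2, e3]
    rfl
  have hcond : Runs (fun p : Σ i, Fin (K i) => N p.1)
      (Code.lt (Code.comp Code.left (Code.var 0)) (Code.var 6)) (fun p => x p.1 p.2)
      fun _ => Data.atom 1 := by
    refine Runs.congr (Decides.lt (a := fun p => (c p.1 p.2).phase)
      ⟨Runs.comp (Runs.var 0) Runs.left, ?_⟩
      (Counts.var 6 (hM.reindex Sigma.fst) fun _ => rfl)) fun p => Data.bool_of (hlt p.1 p.2 p.2.2)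
    exact (hM.reindex Sigma.fst).mono fun p => (hlt p.1 p.2 p.2.2).le
  have hend : Runs N (Code.lt (Code.comp Code.left (Code.var 0)) (Code.var 6))
      (fun i => x i (K i)) fun _ => Data.atom 0 :=
    Runs.congr (Decides.lt (a := fun i => (c i (K i)).phase)
      ⟨Runs.comp (Runs.var 0) Runs.left, hM.mono fun i => (heq i).le⟩
      (Counts.var 6 hM fun _ => rfl)) fun i => Data.bool_of_not (heq i).not_lt
  have hbody : Runs (fun p : Σ i, Fin (K i) => N p.1)
      (Code.comp (Code.next d B) (Code.choice d B ▹ Code.var 0 ▹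
        Code.comp Code.right (Code.comp Code.right Code.right)) ▹
        Code.comp Code.right (Code.var 1) ▹ (Code.var 0 ▹ Code.var 2) ▹
          Code.comp Code.right (Code.comp Code.right Code.right)) (fun p => x p.1 p.2)
      fun p => x p.1 (p.2 + 1) := by
    have hs : ∀ p : Σ i, Fin (K i), (c p.1 p.2).state ∈ (Γ p.1).states := fun p =>
      trace_mem (h.best p.1) (h.init p.1) _
    have hc : ∀ p : Σ i, Fin (K i), (c p.1 p.2).phase ≤ (Γ p.1).numPhases (br p.1) (s₀ p.1) :=
      fun p => (hlt p.1 p.2 p.2.2).le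
    have hR : Runs (fun p : Σ i, Fin (K i) => N p.1)
        (Code.comp Code.right (Code.comp Code.right Code.right)) (fun p => x p.1 p.2)
        fun p => (Γ p.1).setup (br p.1) (s₀ p.1) :=
      Runs.comp (Runs.comp Runs.right Runs.right) Runs.right
    have hchoice := runs_choice hd h' (fun p => hB p.1) hs hc (fun p => (prefs p.1).drop p.2)
      fun p => out p.1 p.2
    have hnext := runs_next h' (fun p => hB p.1) hs hc fun p =>
      choose (br p.1) (s₀ p.1) (c p.1 p.2) ((prefs p.1).drop p.2)
    refine ((Runs.comp (hchoice.pair ((Runs.var 0).pair hR)) hnext).pair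
      ((Runs.comp (Runs.var 1) Runs.right).pair
        (((Runs.var 0).pair (Runs.var 2)).pair hR))).congr fun p => ?_
    -- Also true when the preferences are exhausted, since `right` then returns the leaf `0`, the
    -- empty list.
    have e1 : (rest p.1 p.2).right = rest p.1 (p.2 + 1) := by
      have := Data.dropEntries_ofList (fun u : Fin (Γ p.1).n => Data.atom (u : ℕ))
        ((prefs p.1).drop p.2) 1
      rw [List.drop_drop] at this
      exact this
    have e2 : (c p.1 p.2).encode ∷ out p.1 p.2 = out p.1 (p.2 + 1) := by
      simp only [out, List.range_succ, List.map_append, List.map_singleton, List.reverse_append,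
        List.reverse_singleton, List.singleton_append, Data.ofList]
    change _ ∷ (rest p.1 p.2).right ∷ ((c p.1 p.2).encode ∷ out p.1 p.2) ∷ _ = _
    rw [e1, e2]
    rfl
  have hloop := Runs.loop hK (v := fun _ _ => Data.atom 1) hcond (by simp) hbody hend
  -- The loop stops before recording the final configuration, so it is put in front of the output
  -- before the reversal.
  have hrev : Runs N (Code.reverse (Code.var 0 ▹ Code.var 2)) (fun i => x i (K i))
      fun i => Data.ofList Config.encode ((List.range (K i + 1)).map (c i)).reverse.reverse :=
    Runs.reverse (l := fun i => ((List.range (K i + 1)).map (c i)).reverse)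
      ((hK.add (PolyBdd.const 1)).mono fun i => by simp)
      (((Runs.var 0).pair (Runs.var 2)).congr fun i => by
        rw [List.range_succ, List.map_append, List.map_singleton, List.reverse_append]
        rfl)
  exact (Runs.comp (Runs.comp hinit hloop) hrev).congr fun i => by rw [List.reverse_reverse]

end Programs

/-- The inputs of the algorithm, for a best-response routine `B` with running time `q`. -/
structure Instance (d : ℕ) (B : Code) (q : Polynomial ℕ) where
  game : Game d
  rule : game.ResponseRule
  best : game.IsBestResponseRule rule
  computes : game.ComputesWithin B rule q
  pos : game.PositiveCosts
  start : game.Profile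
  start_mem : start ∈ game.states
  prefs : List (Fin game.n)

/-- All games with all rules and initial states form one family with `N` the number of bits, so
`PolyBdd` yields a single polynomial for all of them. -/
theorem exists_polynomial_moves (d : ℕ) (hd : 1 ≤ d) :
    ∃ Q : Polynomial ℕ, ∀ (Γ : Game d) (br : Γ.ResponseRule),
      Γ.IsBestResponseRule br → Γ.PositiveCosts → ∀ s₀ ∈ Γ.states,
        Γ.numPhases br s₀ ≤ Q.eval Γ.bits ∧
        ∀ L : List Γ.Config, Game.IsPartialRun br s₀ L →
          ∀ i : ℕ, Game.movesInPhase L i ≤ Q.eval Γ.bits := by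
  let ι := Σ Γ : Game d, {p : Γ.ResponseRule × Γ.Profile //
    Γ.IsBestResponseRule p.1 ∧ Γ.PositiveCosts ∧ p.2 ∈ Γ.states}
  have h : IsFamily (fun i : ι => i.1.bits) (fun i => i.1) (fun i => i.2.1.1) fun i => i.2.1.2 :=
    ⟨PolyBdd.self, fun i => i.2.2.1, fun i => i.2.2.2.1, fun i => i.2.2.2.2⟩
  obtain ⟨Q, hQ⟩ := h.polyBdd_numPhases.add h.polyBdd_moveBound
  refine ⟨Q, fun Γ br hbr hpos s₀ hs => ?_⟩
  have := hQ ⟨Γ, (br, s₀), hbr, hpos, hs⟩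
  simp only at this
  exact ⟨by omega, fun L hL i => (movesInPhase_le hd hbr hpos hs hL i).trans (by omega)⟩

/-- The family is that of all instances, preference lists included, and `N` counts only the bits of
the game. The bound is therefore uniform in the initial state and in the list. -/
theorem exists_polynomial_time (d : ℕ) (hd : 1 ≤ d) (B : Code) (q : Polynomial ℕ) :
    ∃ P : Polynomial ℕ, ∀ (Γ : Game d) (br : Γ.ResponseRule),
      Γ.IsBestResponseRule br → Γ.ComputesWithin B br q → Γ.PositiveCosts →
        ∀ s₀ ∈ Γ.states, ∀ prefs : List (Fin Γ.n),
          ∃ L : List Γ.Config, Game.IsCompleteRun br s₀ L ∧ Game.Follows br s₀ prefs L ∧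
            ∃ t ≤ P.eval Γ.bits, Eval (Code.algorithm d B) (Game.algInput s₀ prefs)
              (Data.ofList Game.Config.encode L) t := by
  have h : IsFamily (fun i : Instance d B q => i.game.bits) (fun i => i.game) (fun i => i.rule)
      fun i => i.start := ⟨PolyBdd.self, fun i => i.best, fun i => i.pos, fun i => i.start_mem⟩
  have hK := fun i : Instance d B q =>
    exists_trace_phase_eq i.prefs hd i.best i.pos i.start_mem
  choose K hK heq hlt using hK
  obtain ⟨t, ⟨P, hP⟩, ht⟩ := runs_algorithm hd h (fun i => i.computes) (fun i => i.prefs)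
    ((h.polyBdd_numPhases.mul (h.polyBdd_moveBound.add (PolyBdd.const 1))).mono hK) hlt heq
  refine ⟨P, fun Γ br hbr hB hpos s₀ hs prefs => ?_⟩
  let i : Instance d B q := ⟨Γ, br, hbr, hB, hpos, s₀, hs, prefs⟩
  refine ⟨(List.range (K i + 1)).map (trace br s₀ prefs), ⟨isPartialRun_trace (hlt i), ?_⟩,
    follows_trace _, t i, hP i, ht i⟩
  exact ⟨trace br s₀ prefs (K i), by simp [List.range_succ], heq i⟩

end Game

theorem mainTheorem5 (d : ℕ) (hd : 1 ≤ d) :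
    (∃ Q : Polynomial ℕ, ∀ (Γ : Game d) (br : Γ.ResponseRule),
      Γ.IsBestResponseRule br → Γ.PositiveCosts → ∀ s₀ ∈ Γ.states,
        Γ.numPhases br s₀ ≤ Q.eval Γ.bits ∧
        ∀ L : List Γ.Config, Game.IsPartialRun br s₀ L →
          ∀ i : ℕ, Game.movesInPhase L i ≤ Q.eval Γ.bits) ∧
    (∀ B : Code, ∃ A : Code, ∀ q : Polynomial ℕ, ∃ P : Polynomial ℕ,
      ∀ (Γ : Game d) (br : Γ.ResponseRule),
        Γ.IsBestResponseRule br → Γ.ComputesWithin B br q → Γ.PositiveCosts →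
          ∀ s₀ ∈ Γ.states, ∀ prefs : List (Fin Γ.n),
            ∃ L : List Γ.Config, Game.IsCompleteRun br s₀ L ∧ Game.Follows br s₀ prefs L ∧
              ∃ t ≤ P.eval Γ.bits,
                Eval A (Game.algInput s₀ prefs) (Data.ofList Game.Config.encode L) t) :=
  ⟨Game.exists_polynomial_moves d hd,
    -- The program depends on `B` alone; the time bound `q` enters only the analysis.
    fun B => ⟨Code.algorithm d B, fun q => Game.exists_polynomial_time d hd B q⟩⟩
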